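/- Let $k\in\mathbb R$ with $e^k+e^{-k}\in\mathbb Z\setminus\{2\}$, and let $G_k$ be the Lie group of matrices $$\begin{pmatrix} e^{kz}&0&0&x\\0&e^{-kz}&0&y\\0&0&1&z\\0&0&0&1\end{pmatrix},\qquad x,y,z\in\mathbb R.$$ Let $\Gamma\subset G_k$ be a discrete subgroup such that $N=G_k/\Gamma$ is compact, and let $\alpha,\beta,\gamma$ be the $1$-forms on $N$ induced by the right invariant forms $dx-kx\,dz$, $dy+ky\,dz$, $dz$. Let $n\neq 0$ be an integer, $\lambda\neq 0$ a real number, $\pi:M\to N$ a smooth principal $S^1$-bundle ($S^1=\mathbb R/\mathbb Z$) and $\eta$ a connection form on $M$ with curvature $n\lambda\,\alpha\wedge\beta$, that is, $d\eta=n\lambda\,\alpha\wedge\beta$, where the pullbacks of $\alpha,\beta,\gamma$ to $M$ are denoted by the same letters. (So $M$ has real Chern class $n\lambda[\alpha\wedge\beta]$, up to the sign convention.) For a closed $1$-form $\omega$ write $d_\omega\theta=d\theta+\omega\wedge\theta$. A locally conformal symplectic form with Lee form $\omega$ is a nondegenerate $2$-form $\Theta$ with $d\Theta=-\omega\wedge\Theta$,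 where $\omega$ is a closed $1$-form. Put $\omega=-k\gamma$, $\omega'=k\gamma$ and $$\Omega=n\lambda\,\alpha\wedge\beta-k\,\gamma\wedge\eta,\qquad \Omega'=n\lambda\,\alpha\wedge\beta+k\,\gamma\wedge\eta,$$ $$\Omega_{(t_1,t_2,t_3)}=t_1\,\alpha\wedge\eta+t_2\,\beta\wedge\gamma+t_3(n\lambda\,\alpha\wedge\beta-k\,\gamma\wedge\eta),$$ $$\Omega_{(s_1,s_2,s_3)}=s_1\,\beta\wedge\eta+s_2\,\alpha\wedge\gamma+s_3(n\lambda\,\alpha\wedge\beta+k\,\gamma\wedge\eta).$$ Then $\Omega=d_\omega\eta$ and $\Omega'=d_{\omega'}\eta$ are locally conformal symplectic forms on $M$, with Lee forms $\omega$ and $\omega'$ respectively. For all real $t_1,t_2,t_3$ with $t_1t_2\neq 0$ and $t_1t_2\neq nk\lambda t_3^2$, the form $\Omega$ is not equivalent to $\Omega_{(t_1,t_2,t_3)}$: there are no diffeomorphism $\phi$ of $M$ and smooth function $f$ on $M$ with $\phi^*\Omega=f\,\Omega_{(t_1,t_2,t_3)}$. Likewise, for all real $s_1,s_2,s_3$ with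 $s_1s_2\neq 0$ and $s_1s_2\neq nk\lambda s_3^2$, there are no diffeomorphism $\phi$ of $M$ and smooth function $f$ on $M$ with $\phi^*\Omega'=f\,\Omega_{(s_1,s_2,s_3)}$. -/

import Mathlib

open scoped Manifold ContDiff

noncomputable section

namespace ACFM

/-! ### Differential forms on manifolds without boundary -/

section Forms

variable {E : Type*} [NormedAddCommGroup E] [NormedSpace ℝ E]
  {M : Type*} [TopologicalSpace M] [ChartedSpace E M]
  {E' : Type*} [NormedAddCommGroup E'] [NormedSpace ℝ E']
  {M' : Type*} [TopologicalSpace M'] [ChartedSpace E' M']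

variable (E M) in
/-- (Not necessarily continuous) real differential forms of degree `p` on a manifold `M`
modelled on the normed space `E`: alternating forms on the tangent spaces `T_x M`, each of which
is, by definition in Mathlib, the vector space `E`. -/
abbrev DForm (p : ℕ) : Type _ := M → E [⋀^Fin p]→L[ℝ] ℝ

/-- The differential `T_x M → T_{F x} M'` of a map. -/
def diffAt (F : M → M') (x : M) : E →L[ℝ] E' := mfderiv 𝓘(ℝ, E) 𝓘(ℝ, E') F x

/-- The pullback `F^* θ` of a differential form along a map. -/
def pullback {p : ℕ} (F : M → M') (θ : DForm E' M' p) : DForm E M p :=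
  fun x => (θ (F x)).compContinuousLinearMap (diffAt F x)

/-- The expression of a form in the preferred chart at `x₀`: its pullback along the inverse of
the chart. It is meaningful on the target of the chart, an open subset of `E`. -/
def inChart {p : ℕ} (x₀ : M) (θ : DForm E M p) : DForm E E p :=
  pullback (extChartAt 𝓘(ℝ, E) x₀).symm θ

/-- A form is smooth if all its expressions in charts are smooth. -/
def IsSmooth {p : ℕ} (θ : DForm E M p) : Prop :=
  ∀ x₀ : M, ContDiffOn ℝ ∞ (inChart x₀ θ) (extChartAt 𝓘(ℝ, E) x₀).target

/-- The exterior derivative, computed at each point in the preferred chart at that point. -/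
def extD {p : ℕ} (θ : DForm E M p) : DForm E M (p + 1) :=
  fun x => (extDeriv (inChart x θ) (extChartAt 𝓘(ℝ, E) x x)).compContinuousLinearMap
    (diffAt (extChartAt 𝓘(ℝ, E) x) x)

/-- The wedge product of a covector with an alternating `p`-form,
`(a ∧ b) (v₀, …, v_p) = ∑ i, (-1) ^ i * a v_i * b (v₀, …, v̂_i, …, v_p)`. -/
def wedgeAlt {p : ℕ} (a : E [⋀^Fin 1]→L[ℝ] ℝ) (b : E [⋀^Fin p]→L[ℝ] ℝ) :
    E [⋀^Fin (p + 1)]→L[ℝ] ℝ :=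
  ContinuousAlternatingMap.alternatizeUncurryFin
    (((ContinuousAlternatingMap.ofSubsingleton ℝ E ℝ (0 : Fin 1)).symm a).smulRight b)

/-- The wedge product of a `1`-form with a `p`-form. -/
def wedge {p : ℕ} (a : DForm E M 1) (b : DForm E M p) : DForm E M (p + 1) :=
  fun x => wedgeAlt (a x) (b x)

/-- The Lichnerowicz differential `d_w θ = dθ + w ∧ θ`. -/
def lichD {p : ℕ} (w : DForm E M 1) (θ : DForm E M p) : DForm E M (p + 1) :=
  extD θ + wedge w θ

/-- `Ω` is a locally conformal symplectic form with Lee form `w`: `Ω` is a smooth nondegenerate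
`2`-form, `w` is a smooth closed `1`-form, and `dΩ = - w ∧ Ω`. -/
structure IsLCS (Ω : DForm E M 2) (w : DForm E M 1) : Prop where
  smooth : IsSmooth Ω
  nondegenerate : ∀ (x : M) (v : E), v ≠ 0 → ∃ u : E, Ω x ![v, u] ≠ 0
  lee_smooth : IsSmooth w
  lee_closed : extD w = 0
  extD_eq : extD Ω = -wedge w Ω

end Forms

/-! ### Principal circle bundles and connection forms -/

section Bundles

variable {E : Type*} [NormedAddCommGroup E] [NormedSpace ℝ E]
  {M : Type*} [TopologicalSpace M] [ChartedSpace E M] [MulAction Circle M]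
  {E' : Type*} [NormedAddCommGroup E'] [NormedSpace ℝ E']
  {N : Type*} [TopologicalSpace N] [ChartedSpace E' N]

/-- `π : M → N` is a smooth principal `S¹`-bundle: `S¹` acts smoothly on `M`, and `N` is covered
by open sets `U` with an equivariant diffeomorphism `π⁻¹(U) ≃ U × S¹` over `U`. -/
structure IsPrincipalCircleBundle (π : M → N) : Prop where
  smooth_smul : ContMDiff ((𝓡 1).prod 𝓘(ℝ, E)) 𝓘(ℝ, E) ∞ (fun q : Circle × M => q.1 • q.2)
  locally_trivial : ∀ b : N, ∃ U : Set N, IsOpen U ∧ b ∈ U ∧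
    ∃ Φ : PartialDiffeomorph 𝓘(ℝ, E) (𝓘(ℝ, E').prod (𝓡 1)) M (N × Circle) ∞,
      Φ.source = π ⁻¹' U ∧ Φ.target = U ×ˢ Set.univ ∧
      (∀ m ∈ Φ.source, (Φ m).1 = π m) ∧
      ∀ m ∈ Φ.source, ∀ z : Circle, z • m ∈ Φ.source ∧ Φ (z • m) = ((Φ m).1, z * (Φ m).2)

/-- The fundamental vector field of a circle action, where `S¹` is parametrized as `ℝ / ℤ`:
the velocity at `s = 0` of `s ↦ exp (2 π i s) • m`. -/
def fundamentalField (m : M) : E :=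
  diffAt (E := ℝ) (fun s : ℝ => Circle.exp (2 * Real.pi * s) • m) 0 1

/-- A connection form on a principal `S¹`-bundle (with `Lie S¹` identified with `ℝ` so that
`S¹ = ℝ / ℤ`): a smooth invariant `1`-form that equals `1` on the fundamental vector field. -/
structure IsConnectionForm (η : DForm E M 1) : Prop where
  smooth : IsSmooth η
  invariant : ∀ z : Circle, pullback (fun m : M => z • m) η = η
  fundamental : ∀ m : M, η m ![fundamentalField m] = 1

end Bundles

/-! ### The solvable group `G_k` -/

/-- The group `G_k`, as a manifold: `ℝ³` with global coordinates `x, y, z` of index `0, 1, 2`. -/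
def Gk (_k : ℝ) : Type := EuclideanSpace ℝ (Fin 3)

namespace Gk

variable {k : ℝ}

instance : TopologicalSpace (Gk k) := inferInstanceAs (TopologicalSpace (EuclideanSpace ℝ (Fin 3)))

instance : ChartedSpace (EuclideanSpace ℝ (Fin 3)) (Gk k) :=
  inferInstanceAs (ChartedSpace (EuclideanSpace ℝ (Fin 3)) (EuclideanSpace ℝ (Fin 3)))

instance : IsManifold 𝓘(ℝ, EuclideanSpace ℝ (Fin 3)) ∞ (Gk k) :=
  inferInstanceAs (IsManifold 𝓘(ℝ, EuclideanSpace ℝ (Fin 3)) ∞ (EuclideanSpace ℝ (Fin 3)))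

instance : T2Space (Gk k) := inferInstanceAs (T2Space (EuclideanSpace ℝ (Fin 3)))

/-- The point with given coordinates. -/
def mk (k x y z : ℝ) : Gk k := (!₂[x, y, z] : EuclideanSpace ℝ (Fin 3))

/-- The coordinate `x`. -/
def x (g : Gk k) : ℝ := WithLp.ofLp (p := 2) (V := Fin 3 → ℝ) g 0

/-- The coordinate `y`. -/
def y (g : Gk k) : ℝ := WithLp.ofLp (p := 2) (V := Fin 3 → ℝ) g 1

/-- The coordinate `z`. -/
def z (g : Gk k) : ℝ := WithLp.ofLp (p := 2) (V := Fin 3 → ℝ) g 2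

@[simp] theorem x_mk (a b c : ℝ) : (mk k a b c).x = a := by simp [mk, x]
@[simp] theorem y_mk (a b c : ℝ) : (mk k a b c).y = b := by simp [mk, y]
@[simp] theorem z_mk (a b c : ℝ) : (mk k a b c).z = c := by simp [mk, z]

theorem ext {g h : Gk k} (hx : g.x = h.x) (hy : g.y = h.y) (hz : g.z = h.z) : g = h := by
  refine PiLp.ext (p := 2) (α := fun _ : Fin 3 => ℝ) fun i => ?_
  fin_cases i
  exacts [hx, hy, hz]

theorem continuous_x : Continuous (x : Gk k → ℝ) :=
  (EuclideanSpace.proj (𝕜 := ℝ) (0 : Fin 3) : EuclideanSpace ℝ (Fin 3) →L[ℝ] ℝ).continuous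
theorem continuous_y : Continuous (y : Gk k → ℝ) :=
  (EuclideanSpace.proj (𝕜 := ℝ) (1 : Fin 3) : EuclideanSpace ℝ (Fin 3) →L[ℝ] ℝ).continuous
theorem continuous_z : Continuous (z : Gk k → ℝ) :=
  (EuclideanSpace.proj (𝕜 := ℝ) (2 : Fin 3) : EuclideanSpace ℝ (Fin 3) →L[ℝ] ℝ).continuous

theorem continuous_mk {X : Type*} [TopologicalSpace X] {a b c : X → ℝ} (ha : Continuous a)
    (hb : Continuous b) (hc : Continuous c) : Continuous fun t => mk k (a t) (b t) (c t) := by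
  have h : Continuous fun t => (![a t, b t, c t] : Fin 3 → ℝ) := by
    refine continuous_pi fun i => ?_
    fin_cases i
    exacts [ha, hb, hc]
  have h' := (PiLp.continuous_toLp 2 (fun _ : Fin 3 => ℝ)).comp h
  exact h'

instance : Mul (Gk k) :=
  ⟨fun g h => mk k (Real.exp (k * g.z) * h.x + g.x) (Real.exp (-(k * g.z)) * h.y + g.y)
    (g.z + h.z)⟩

instance : One (Gk k) := ⟨mk k 0 0 0⟩

instance : Inv (Gk k) :=
  ⟨fun g => mk k (-(Real.exp (-(k * g.z)) * g.x)) (-(Real.exp (k * g.z) * g.y)) (-g.z)⟩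

theorem mul_def (g h : Gk k) : g * h = mk k (Real.exp (k * g.z) * h.x + g.x)
    (Real.exp (-(k * g.z)) * h.y + g.y) (g.z + h.z) := rfl
theorem one_def : (1 : Gk k) = mk k 0 0 0 := rfl
theorem inv_def (g : Gk k) : g⁻¹ = mk k (-(Real.exp (-(k * g.z)) * g.x))
    (-(Real.exp (k * g.z) * g.y)) (-g.z) := rfl

instance : Group (Gk k) :=
  Group.ofLeftAxioms
    (fun a b c => by
      apply ext <;> simp only [mul_def, x_mk, y_mk, z_mk]
      · rw [mul_add, Real.exp_add]; ring
      · rw [mul_add, neg_add, Real.exp_add]; ring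
      · ring)
    (fun a => by apply ext <;> simp [mul_def, one_def])
    (fun a => by
      apply ext <;> simp [mul_def, one_def, inv_def])

instance : IsTopologicalGroup (Gk k) where
  continuous_mul := by
    have h1 := (continuous_x (k := k)).comp (continuous_fst (Y := Gk k))
    have h2 := (continuous_y (k := k)).comp (continuous_fst (Y := Gk k))
    have h3 := (continuous_z (k := k)).comp (continuous_fst (Y := Gk k))
    have h4 := (continuous_x (k := k)).comp (continuous_snd (X := Gk k))
    have h5 := (continuous_y (k := k)).comp (continuous_snd (X := Gk k))
    have h6 := (continuous_z (k := k)).comp (continuous_snd (X := Gk k))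
    exact continuous_mk
      (((Real.continuous_exp.comp (continuous_const.mul h3)).mul h4).add h1)
      (((Real.continuous_exp.comp (continuous_const.mul h3).neg).mul h5).add h2) (h3.add h6)
  continuous_inv :=
    continuous_mk
      ((Real.continuous_exp.comp (continuous_const.mul continuous_z).neg).mul continuous_x).neg
      ((Real.continuous_exp.comp (continuous_const.mul continuous_z)).mul continuous_y).neg
      continuous_z.neg

/-- The matrix with coordinates `x, y, z`. -/
def toMatrix (g : Gk k) : Matrix (Fin 4) (Fin 4) ℝ :=
  !![Real.exp (k * g.z), 0, 0, g.x;
     0, Real.exp (-(k * g.z)), 0, g.y;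
     0, 0, 1, g.z;
     0, 0, 0, 1]

/-- The group law of `G_k` is multiplication of matrices. -/
theorem toMatrix_mul (g h : Gk k) : (g * h).toMatrix = g.toMatrix * h.toMatrix := by
  ext i j
  fin_cases i <;> fin_cases j <;>
    simp [toMatrix, mul_def, Matrix.mul_apply, Fin.sum_univ_four, mul_add, Real.exp_add, mul_comm,
      add_comm]

theorem toMatrix_injective : Function.Injective (toMatrix (k := k)) := by
  intro g h e
  have h0 := congrFun (congrFun e 0) 3
  have h1 := congrFun (congrFun e 1) 3
  have h2 := congrFun (congrFun e 2) 3
  exact ext (by simpa [toMatrix] using h0) (by simpa [toMatrix] using h1)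
    (by simpa [toMatrix] using h2)

/-- The value at `g` of the `1`-form `a dx + b dy + c dz`. -/
def covector (a b c : ℝ) : EuclideanSpace ℝ (Fin 3) [⋀^Fin 1]→L[ℝ] ℝ :=
  ContinuousAlternatingMap.ofSubsingleton ℝ (EuclideanSpace ℝ (Fin 3)) ℝ (0 : Fin 1)
    (a • EuclideanSpace.proj 0 + b • EuclideanSpace.proj 1 + c • EuclideanSpace.proj 2)

theorem covector_apply (a b c : ℝ) (v : Fin 1 → EuclideanSpace ℝ (Fin 3)) :
    covector a b c v = a * v 0 0 + b * v 0 1 + c * v 0 2 := by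
  simp [covector]

variable (k)

/-- The right invariant `1`-form `dx - k x dz`. -/
def alpha : DForm (EuclideanSpace ℝ (Fin 3)) (Gk k) 1 := fun g => covector 1 0 (-(k * g.x))

/-- The right invariant `1`-form `dy + k y dz`. -/
def beta : DForm (EuclideanSpace ℝ (Fin 3)) (Gk k) 1 := fun g => covector 0 1 (k * g.y)

/-- The right invariant `1`-form `dz`. -/
def gamma : DForm (EuclideanSpace ℝ (Fin 3)) (Gk k) 1 := fun _ => covector 0 0 1

end Gk

/-! ### The quotient manifold `G_k / Γ` -/

section Quotient

variable {k : ℝ} (Γ : Subgroup (Gk k)) [DiscreteTopology Γ]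

theorem isLocalHomeomorph_mk : IsLocalHomeomorph (QuotientGroup.mk : Gk k → Gk k ⧸ Γ) :=
  (Γ.isQuotientCoveringMap ⟨inferInstance⟩).isCoveringMap.isLocalHomeomorph

/-- The smooth structure of `G_k / Γ`: the charts are the local inverses of `G_k → G_k / Γ`. -/
instance : ChartedSpace (EuclideanSpace ℝ (Fin 3)) (Gk k ⧸ Γ) where
  atlas := {(isLocalHomeomorph_mk Γ).localInverseAt g | g : Gk k}
  chartAt q := (isLocalHomeomorph_mk Γ).localInverseAt q.out
  mem_chart_source q := by
    have := (isLocalHomeomorph_mk Γ).apply_self_mem_localInverseAt_source (x := q.out)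
    rwa [QuotientGroup.out_eq'] at this
  chart_mem_atlas q := ⟨q.out, rfl⟩

/-- Right translations are smooth. -/
theorem contDiff_mul_right (h : Gk k) :
    ContDiff ℝ ∞ (fun g : EuclideanSpace ℝ (Fin 3) =>
      (show EuclideanSpace ℝ (Fin 3) from (show Gk k from g) * h)) := by
  rw [contDiff_euclidean]
  have hp : ∀ i : Fin 3, ContDiff ℝ ∞ (fun g : EuclideanSpace ℝ (Fin 3) => g i) := fun i =>
    (EuclideanSpace.proj (𝕜 := ℝ) i : EuclideanSpace ℝ (Fin 3) →L[ℝ] ℝ).contDiff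
  intro i
  fin_cases i
  · exact ((Real.contDiff_exp.comp (contDiff_const.mul (hp 2))).mul contDiff_const).add (hp 0)
  · exact ((Real.contDiff_exp.comp (contDiff_const.mul (hp 2)).neg).mul contDiff_const).add (hp 1)
  · exact (hp 2).add contDiff_const

/-- A continuous lift of `g ↦ gΓ` is locally a right translation. -/
theorem eventually_eq_mul {h : Gk k → Gk k} {s : Set (Gk k)} (hs : IsOpen s)
    (hc : ContinuousOn h s) (hq : ∀ g ∈ s, (h g : Gk k ⧸ Γ) = (g : Gk k ⧸ Γ)) {g₀ : Gk k}
    (hg₀ : g₀ ∈ s) : ∀ᶠ g in nhds g₀, h g = g * (g₀⁻¹ * h g₀) := by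
  have hmem : ∀ g ∈ s, g⁻¹ * h g ∈ Γ := fun g hg => QuotientGroup.eq.1 (hq g hg).symm
  have hcont : ContinuousOn (fun g => g⁻¹ * h g) s := continuousOn_id.inv.mul hc
  have hcΓ : Continuous (fun g : s => (⟨(g : Gk k)⁻¹ * h g, hmem g g.2⟩ : Γ)) :=
    Continuous.subtype_mk (continuousOn_iff_continuous_domRestrict.1 hcont) _
  have hev : ∀ᶠ g : s in nhds ⟨g₀, hg₀⟩, (⟨(g : Gk k)⁻¹ * h g, hmem g g.2⟩ : Γ)
      = ⟨g₀⁻¹ * h g₀, hmem g₀ hg₀⟩ := by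
    have := hcΓ.tendsto ⟨g₀, hg₀⟩
    rw [nhds_discrete Γ, Filter.tendsto_pure] at this
    exact this
  rw [nhds_subtype_eq_comap, Filter.eventually_comap] at hev
  filter_upwards [hev, hs.mem_nhds hg₀] with g hg hgs
  have := congrArg Subtype.val (hg ⟨g, hgs⟩ rfl)
  simp only at this
  rw [← this, mul_inv_cancel_left]

instance : IsManifold 𝓘(ℝ, EuclideanSpace ℝ (Fin 3)) ∞ (Gk k ⧸ Γ) := by
  apply isManifold_of_contDiffOn
  rintro _ _ ⟨g₁, rfl⟩ ⟨g₂, rfl⟩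
  set e₁ := (isLocalHomeomorph_mk Γ).localInverseAt g₁
  set e₂ := (isLocalHomeomorph_mk Γ).localInverseAt g₂
  let t : OpenPartialHomeomorph (Gk k) (Gk k) := e₁.symm.trans e₂
  have ht : ContDiffOn (E := EuclideanSpace ℝ (Fin 3)) (F := EuclideanSpace ℝ (Fin 3)) ℝ ∞
      t t.source := by
    intro g₀ hg₀
    have hq : ∀ g ∈ t.source, ((t g : Gk k) : Gk k ⧸ Γ) = (g : Gk k ⧸ Γ) := by
      intro g hg
      have h2 : e₁.symm g ∈ e₂.source := by
        rw [OpenPartialHomeomorph.trans_source] at hg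
        exact hg.2
      have h3 := (isLocalHomeomorph_mk Γ).apply_localInverseAt_of_mem h2
      have h4 : e₁.symm g = (g : Gk k ⧸ Γ) :=
        congrFun ((isLocalHomeomorph_mk Γ).localInverseAt_symm (x := g₁)) g
      rw [← h4]; exact h3
    have := eventually_eq_mul Γ t.open_source t.continuousOn hq hg₀
    exact ((contDiff_mul_right ((show Gk k from g₀)⁻¹ * t g₀)).contDiffAt.congr_of_eventuallyEq
      this).contDiffWithinAt
  simp only [modelWithCornersSelf_coe, modelWithCornersSelf_coe_symm, Function.comp_id,
    Function.id_comp, Set.preimage_id, Set.range_id, Set.inter_univ]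
  exact ht

/-- The projection `G_k → G_k / Γ` is a local diffeomorphism. -/
theorem isLocalDiffeomorph_mk :
    IsLocalDiffeomorph 𝓘(ℝ, EuclideanSpace ℝ (Fin 3)) 𝓘(ℝ, EuclideanSpace ℝ (Fin 3)) ∞
      (QuotientGroup.mk : Gk k → Gk k ⧸ Γ) := by
  intro g
  set e := (isLocalHomeomorph_mk Γ).localInverseAt g with he
  have hmem : e ∈ IsManifold.maximalAtlas 𝓘(ℝ, EuclideanSpace ℝ (Fin 3)) ∞ (Gk k ⧸ Γ) :=
    IsManifold.subset_maximalAtlas ⟨g, rfl⟩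
  refine ⟨⟨e.symm.toPartialEquiv, e.open_target, e.open_source,
    contMDiffOn_symm_of_mem_maximalAtlas hmem, contMDiffOn_of_mem_maximalAtlas hmem⟩,
    (isLocalHomeomorph_mk Γ).self_mem_localInverseAt_target, fun x _ => ?_⟩
  exact (congrFun ((isLocalHomeomorph_mk Γ).localInverseAt_symm (x := g)) x).symm

/-- The form on `G_k / Γ` induced by a form on `G_k` that is invariant under right translations:
its value at a coset `gΓ` is transported by the differential of the projection at a
representative `g` (which does not matter, see `pullback_mk_descend`). -/
def descend {p : ℕ} (θ : DForm (EuclideanSpace ℝ (Fin 3)) (Gk k) p) :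
    DForm (EuclideanSpace ℝ (Fin 3)) (Gk k ⧸ Γ) p :=
  fun q => (θ q.out).compContinuousLinearMap
    (diffAt (QuotientGroup.mk : Gk k → Gk k ⧸ Γ) q.out).inverse

theorem pullback_mk_descend {p : ℕ} (θ : DForm (EuclideanSpace ℝ (Fin 3)) (Gk k) p)
    (hθ : ∀ h : Gk k, pullback (fun g : Gk k => g * h) θ = θ) :
    pullback (QuotientGroup.mk : Gk k → Gk k ⧸ Γ) (descend Γ θ) = θ := by
  funext g
  obtain ⟨h, hh⟩ := QuotientGroup.mk_out_eq_mul Γ g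
  have hd : ∀ a, MDifferentiableAt 𝓘(ℝ, EuclideanSpace ℝ (Fin 3))
      𝓘(ℝ, EuclideanSpace ℝ (Fin 3)) (QuotientGroup.mk : Gk k → Gk k ⧸ Γ) a := fun a =>
    ((isLocalDiffeomorph_mk Γ) a).mdifferentiableAt (by simp)
  have hR : MDifferentiableAt 𝓘(ℝ, EuclideanSpace ℝ (Fin 3))
      𝓘(ℝ, EuclideanSpace ℝ (Fin 3)) (fun g : Gk k => g * (h : Gk k)) g :=
    ((contDiff_mul_right (h : Gk k)).differentiable (by simp)).differentiableAt.mdifferentiableAt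
  have hcomp : (QuotientGroup.mk : Gk k → Gk k ⧸ Γ) ∘ (fun g : Gk k => g * (h : Gk k))
      = QuotientGroup.mk := by
    funext a; simp
  have hder := mfderiv_comp g (hd (g * h)) hR
  rw [hcomp] at hder
  let L : EuclideanSpace ℝ (Fin 3) ≃L[ℝ] EuclideanSpace ℝ (Fin 3) :=
    (isLocalDiffeomorph_mk Γ).mfderivToContinuousLinearEquiv (by simp) (g * (h : Gk k))
  have hder' : diffAt (E := EuclideanSpace ℝ (Fin 3)) (E' := EuclideanSpace ℝ (Fin 3))
        (QuotientGroup.mk : Gk k → Gk k ⧸ Γ) g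
      = (diffAt (E := EuclideanSpace ℝ (Fin 3)) (E' := EuclideanSpace ℝ (Fin 3))
        (QuotientGroup.mk : Gk k → Gk k ⧸ Γ) (g * h)).comp
        (diffAt (E := EuclideanSpace ℝ (Fin 3)) (E' := EuclideanSpace ℝ (Fin 3)) (fun g : Gk k => g * (h : Gk k)) g) := hder
  have hL : diffAt (E := EuclideanSpace ℝ (Fin 3)) (E' := EuclideanSpace ℝ (Fin 3))
        (QuotientGroup.mk : Gk k → Gk k ⧸ Γ) (g * h)
      = (L : EuclideanSpace ℝ (Fin 3) →L[ℝ] EuclideanSpace ℝ (Fin 3)) := rfl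
  have key : (diffAt (E := EuclideanSpace ℝ (Fin 3)) (E' := EuclideanSpace ℝ (Fin 3))
        (QuotientGroup.mk : Gk k → Gk k ⧸ Γ) (g * h)).inverse.comp
      (diffAt (E := EuclideanSpace ℝ (Fin 3)) (E' := EuclideanSpace ℝ (Fin 3))
        (QuotientGroup.mk : Gk k → Gk k ⧸ Γ) g)
      = diffAt (E := EuclideanSpace ℝ (Fin 3)) (E' := EuclideanSpace ℝ (Fin 3)) (fun g : Gk k => g * (h : Gk k)) g := by
    rw [hder', hL, ContinuousLinearMap.inverse_equiv]
    ext1 v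
    exact L.symm_apply_apply _
  refine Eq.trans ?_ (congrFun (hθ h) g)
  simp only [pullback, descend, hh, ← key]
  rfl

/-- The differential of a right translation, in coordinates. -/
theorem diffAt_mul_right (g h : Gk k) (v : EuclideanSpace ℝ (Fin 3)) :
    diffAt (fun g : Gk k => g * h) g v
    = !₂[k * Real.exp (k * g.z) * h.x * v 2 + v 0,
        -(k * Real.exp (-(k * g.z)) * h.y * v 2) + v 1, v 2] := by
  have hm : diffAt (fun g : Gk k => g * h) g = fderiv ℝ (fun g : EuclideanSpace ℝ (Fin 3) =>
      (show EuclideanSpace ℝ (Fin 3) from (show Gk k from g) * h)) g := mfderiv_eq_fderiv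
  have hp : ∀ i : Fin 3, HasFDerivAt (fun g : EuclideanSpace ℝ (Fin 3) => g i)
      (EuclideanSpace.proj (𝕜 := ℝ) i : EuclideanSpace ℝ (Fin 3) →L[ℝ] ℝ) g := fun i =>
    (EuclideanSpace.proj (𝕜 := ℝ) i : EuclideanSpace ℝ (Fin 3) →L[ℝ] ℝ).hasFDerivAt
  have hF := ((contDiff_mul_right h).differentiable (by simp) g).hasFDerivAt
  rw [hm]
  have hc : ∀ i : Fin 3, HasFDerivAt (fun a : EuclideanSpace ℝ (Fin 3) =>
      (show EuclideanSpace ℝ (Fin 3) from (show Gk k from a) * h) i)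
      ((EuclideanSpace.proj (𝕜 := ℝ) i : EuclideanSpace ℝ (Fin 3) →L[ℝ] ℝ).comp
        (fderiv ℝ (fun g : EuclideanSpace ℝ (Fin 3) =>
      (show EuclideanSpace ℝ (Fin 3) from (show Gk k from g) * h)) g)) g := fun i =>
    (EuclideanSpace.proj (𝕜 := ℝ) i : EuclideanSpace ℝ (Fin 3) →L[ℝ] ℝ).hasFDerivAt.comp _ hF
  have e0 := congrArg (fun T => T v) ((hc 0).unique
    ((((hp 2).const_mul k).exp.mul_const h.x).add (hp 0)))
  have e1 := congrArg (fun T => T v) ((hc 1).unique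
    ((((hp 2).const_mul k).neg.exp.mul_const h.y).add (hp 1)))
  have e2 := congrArg (fun T => T v) ((hc 2).unique ((hp 2).add_const h.z))
  refine PiLp.ext fun i => ?_
  fin_cases i
  · refine Eq.trans e0 ?_
    simp [Gk.z]; ring
  · refine Eq.trans e1 ?_
    have e3 : (-fun y : EuclideanSpace ℝ (Fin 3) => k * y 2) g = -(k * g.z) := rfl
    rw [e3]
    simp; ring
  · refine Eq.trans e2 ?_
    simp

theorem pullback_mul_right_alpha (h : Gk k) :
    pullback (fun g : Gk k => g * h) (Gk.alpha k) = Gk.alpha k := by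
  have key : ∀ (g : Gk k) (v w : Fin 1 → EuclideanSpace ℝ (Fin 3)),
      w 0 = !₂[k * Real.exp (k * g.z) * h.x * v 0 2 + v 0 0,
        -(k * Real.exp (-(k * g.z)) * h.y * v 0 2) + v 0 1, v 0 2] →
      Gk.covector 1 0 (-(k * (g * h).x)) w = Gk.covector 1 0 (-(k * g.x)) v := by
    intro g v w hw
    rw [Gk.covector_apply, Gk.covector_apply, hw]
    simp [Gk.mul_def]
    ring
  funext g
  ext v
  exact key g v (fun i => diffAt (fun g : Gk k => g * h) g (v i)) (diffAt_mul_right g h (v 0))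

theorem pullback_mul_right_beta (h : Gk k) :
    pullback (fun g : Gk k => g * h) (Gk.beta k) = Gk.beta k := by
  have key : ∀ (g : Gk k) (v w : Fin 1 → EuclideanSpace ℝ (Fin 3)),
      w 0 = !₂[k * Real.exp (k * g.z) * h.x * v 0 2 + v 0 0,
        -(k * Real.exp (-(k * g.z)) * h.y * v 0 2) + v 0 1, v 0 2] →
      Gk.covector 0 1 (k * (g * h).y) w = Gk.covector 0 1 (k * g.y) v := by
    intro g v w hw
    rw [Gk.covector_apply, Gk.covector_apply, hw]
    simp [Gk.mul_def]
    ring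
  funext g
  ext v
  exact key g v (fun i => diffAt (fun g : Gk k => g * h) g (v i)) (diffAt_mul_right g h (v 0))

theorem pullback_mul_right_gamma (h : Gk k) :
    pullback (fun g : Gk k => g * h) (Gk.gamma k) = Gk.gamma k := by
  have key : ∀ (g : Gk k) (v w : Fin 1 → EuclideanSpace ℝ (Fin 3)),
      w 0 = !₂[k * Real.exp (k * g.z) * h.x * v 0 2 + v 0 0,
        -(k * Real.exp (-(k * g.z)) * h.y * v 0 2) + v 0 1, v 0 2] →
      Gk.covector 0 0 1 w = Gk.covector 0 0 1 v := by
    intro g v w hw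
    rw [Gk.covector_apply, Gk.covector_apply, hw]
    simp
  funext g
  ext v
  exact key g v (fun i => diffAt (fun g : Gk k => g * h) g (v i)) (diffAt_mul_right g h (v 0))

/-- The form `α` on `G_k / Γ`. -/
def alphaN : DForm (EuclideanSpace ℝ (Fin 3)) (Gk k ⧸ Γ) 1 := descend Γ (Gk.alpha k)

/-- The form `β` on `G_k / Γ`. -/
def betaN : DForm (EuclideanSpace ℝ (Fin 3)) (Gk k ⧸ Γ) 1 := descend Γ (Gk.beta k)

/-- The form `γ` on `G_k / Γ`. -/
def gammaN : DForm (EuclideanSpace ℝ (Fin 3)) (Gk k ⧸ Γ) 1 := descend Γ (Gk.gamma k)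

theorem pullback_mk_alphaN :
    pullback (QuotientGroup.mk : Gk k → Gk k ⧸ Γ) (alphaN Γ) = Gk.alpha k :=
  pullback_mk_descend Γ _ pullback_mul_right_alpha

theorem pullback_mk_betaN :
    pullback (QuotientGroup.mk : Gk k → Gk k ⧸ Γ) (betaN Γ) = Gk.beta k :=
  pullback_mk_descend Γ _ pullback_mul_right_beta

theorem pullback_mk_gammaN :
    pullback (QuotientGroup.mk : Gk k → Gk k ⧸ Γ) (gammaN Γ) = Gk.gamma k :=
  pullback_mk_descend Γ _ pullback_mul_right_gamma

end Quotient

/-! ### The `2`-forms, in terms of `c = n λ` and of four `1`-forms -/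

section TwoForms

variable {E : Type*} [NormedAddCommGroup E] [NormedSpace ℝ E]
  {M : Type*} [TopologicalSpace M] [ChartedSpace E M]

/-- `Ω = c α ∧ β - k γ ∧ η`. -/
def Omega (k c : ℝ) (α β γ η : DForm E M 1) : DForm E M 2 :=
  c • wedge α β - k • wedge γ η

/-- `Ω' = c α ∧ β + k γ ∧ η`. -/
def Omega' (k c : ℝ) (α β γ η : DForm E M 1) : DForm E M 2 :=
  c • wedge α β + k • wedge γ η

/-- `Ω_(t₁, t₂, t₃) = t₁ α ∧ η + t₂ β ∧ γ + t₃ (c α ∧ β - k γ ∧ η)`. -/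
def OmegaT (k c : ℝ) (α β γ η : DForm E M 1) (t₁ t₂ t₃ : ℝ) : DForm E M 2 :=
  t₁ • wedge α η + t₂ • wedge β γ + t₃ • (c • wedge α β - k • wedge γ η)

/-- `Ω_(s₁, s₂, s₃) = s₁ β ∧ η + s₂ α ∧ γ + s₃ (c α ∧ β + k γ ∧ η)`. -/
def OmegaS (k c : ℝ) (α β γ η : DForm E M 1) (s₁ s₂ s₃ : ℝ) : DForm E M 2 :=
  s₁ • wedge β η + s₂ • wedge α γ + s₃ • (c • wedge α β + k • wedge γ η)

/-- `Θ` is equivalent to `Θ'`: there are a diffeomorphism `φ` of `M` and a smooth function `f`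
such that `φ^* Θ = f Θ'`. -/
def Equivalent (Θ Θ' : DForm E M 2) : Prop :=
  ∃ (φ : Diffeomorph 𝓘(ℝ, E) 𝓘(ℝ, E) M M ∞) (f : M → ℝ),
    ContMDiff 𝓘(ℝ, E) 𝓘(ℝ, ℝ) ∞ f ∧ ∀ x : M, pullback φ Θ x = f x • Θ' x

end TwoForms

end ACFM

end

noncomputable section

namespace ACFM

/-! ### Pullbacks, charts and naturality of the exterior derivative. -/

section Calculus

open Filter Topology

variable {E : Type*} [NormedAddCommGroup E] [NormedSpace ℝ E]
  {M : Type*} [TopologicalSpace M] [ChartedSpace E M]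
  {E' : Type*} [NormedAddCommGroup E'] [NormedSpace ℝ E']
  {M' : Type*} [TopologicalSpace M'] [ChartedSpace E' M']
  {E'' : Type*} [NormedAddCommGroup E''] [NormedSpace ℝ E'']
  {M'' : Type*} [TopologicalSpace M''] [ChartedSpace E'' M'']

/-! The obstruction is Lichnerowicz exactness. Since $\Omega=d_\omega\eta$ is $d_\omega$-exact, any
form equivalent to it is exact for the Lichnerowicz differential of its own Lee form;
$\Omega_{(t_1,t_2,t_3)}$ is not exact once $t_1\neq 0$.

Transport of exactness (`exists_primitive_of_equivalent`). Write $c=n\lambda$ and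
$\Theta=\Omega_{(t_1,t_2,t_3)}$, and suppose $\phi^*\Omega=f\Theta$. As $\Omega$ is nondegenerate,
$f$ has no zero. Both forms satisfy $d\Theta=k\gamma\wedge\Theta$, so differentiating
$\phi^*\Omega=f\Theta$ gives $(df-kf(\phi^*\gamma-\gamma))\wedge\Theta=0$. The condition $t_1t_2\neq
ckt_3^2$ is nondegeneracy of $\Theta$, which makes wedging a covector with $\Theta$ injective
(`eq_zero_of_wedgeAlt_OmegaT`). Hence $df=kf(\phi^*\gamma-\gamma)$, and $\xi=f^{-1}\phi^*\eta$
satisfies $d\xi=\Theta+k\gamma\wedge\xi$.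

Non-exactness (`eq_zero_of_extD_apply_eq`). Let $X$ be the fundamental field and $v$ a lift of
$\partial_x$. Since $\gamma(v)=\gamma(X)=0$, only $t_1\alpha\wedge\eta$ contributes, and
$d\xi(v,X)=t_1$. By Stokes on cylinders (`integral_sub_integral_eq`), the integral of $\xi$ over the
circle fibres is a function on $N$ growing at constant rate $t_1$ along $\partial_x$. It is
continuous and $N$ is compact, so it has a maximum, which forces $t_1=0$.

The second family is the first after exchanging $\alpha$ with $\beta$ and changing the signs of $k$
and $c$; then $\partial_y$ plays the role of $\partial_x$. The rest supplies the exterior calculus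
and shows that $\alpha,\beta,\gamma,\eta$ is a coframe with the expected structure equations
(`isSolCoframe`). -/

theorem diffAt_comp {G : M' → M''} {F : M → M'} {x : M}
    (hG : MDifferentiableAt 𝓘(ℝ, E') 𝓘(ℝ, E'') G (F x))
    (hF : MDifferentiableAt 𝓘(ℝ, E) 𝓘(ℝ, E') F x) :
    diffAt (E := E) (E' := E'') (G ∘ F) x
      = (diffAt (E := E') (E' := E'') G (F x)).comp (diffAt (E := E) (E' := E') F x) :=
  mfderiv_comp x hG hF

theorem diffAt_congr {F G : M → M'} {x : M} (h : F =ᶠ[𝓝 x] G) :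
    diffAt (E := E) (E' := E') F x = diffAt G x :=
  h.mfderiv_eq

theorem pullback_congr {p : ℕ} {F G : M → M'} {x : M} (h : F =ᶠ[𝓝 x] G) (θ : DForm E' M' p) :
    pullback (E := E) F θ x = pullback G θ x := by
  simp only [pullback, diffAt_congr h, h.eq_of_nhds]

theorem pullback_pullback_apply {p : ℕ} {G : M' → M''} {F : M → M'} {x : M}
    (hG : MDifferentiableAt 𝓘(ℝ, E') 𝓘(ℝ, E'') G (F x))
    (hF : MDifferentiableAt 𝓘(ℝ, E) 𝓘(ℝ, E') F x) (θ : DForm E'' M'' p) :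
    pullback (E := E) F (pullback (E := E') G θ) x = pullback (E := E) (G ∘ F) θ x := by
  simp only [pullback, diffAt_comp hG hF]
  rfl

theorem eventually_mdifferentiableAt [IsManifold 𝓘(ℝ, E) ∞ M] [IsManifold 𝓘(ℝ, E') ∞ M']
    {F : M → M'} {x : M}
    (h : ContMDiffAt 𝓘(ℝ, E) 𝓘(ℝ, E') ∞ F x) :
    ∀ᶠ y in 𝓝 x, MDifferentiableAt 𝓘(ℝ, E) 𝓘(ℝ, E') F y := by
  -- Regularity of finite order at a point persists nearby. For order `∞` the neighbourhood may
  -- shrink with the order, so the order is lowered to 1.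
  have h1 : ContMDiffAt 𝓘(ℝ, E) 𝓘(ℝ, E') 1 F x := h.of_le (by simp)
  have : IsManifold 𝓘(ℝ, E) 1 M := .of_le (n := ∞) (by simp)
  have : IsManifold 𝓘(ℝ, E') 1 M' := .of_le (n := ∞) (by simp)
  filter_upwards [contMDiffAt_iff_contMDiffAt_nhds (by simp) |>.1 h1] with y hy
  exact hy.mdifferentiableAt (by simp)

theorem IsSmooth.contDiffAt {p : ℕ} {θ : DForm E M p} (h : IsSmooth θ) {x₀ : M} {y : E}
    (hy : y ∈ (extChartAt 𝓘(ℝ, E) x₀).target) : ContDiffAt ℝ ∞ (inChart x₀ θ) y :=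
  (h x₀).contDiffAt ((isOpen_extChartAt_target x₀).mem_nhds hy)

theorem IsSmooth.differentiableAt {p : ℕ} {θ : DForm E M p} (h : IsSmooth θ) {x₀ : M} {y : E}
    (hy : y ∈ (extChartAt 𝓘(ℝ, E) x₀).target) : DifferentiableAt ℝ (inChart x₀ θ) y :=
  (h.contDiffAt hy).differentiableAt (by simp)

/-- Alternating 1-forms are linearly isometric to functionals, for which smoothness of compositions
is a statement about continuous linear maps. -/
theorem contDiffAt_oneForm_iff {X : Type*} [NormedAddCommGroup X] [NormedSpace ℝ X]
    {θ : X → E [⋀^Fin 1]→L[ℝ] ℝ} {x : X} :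
    ContDiffAt ℝ ∞ θ x ↔ ContDiffAt ℝ ∞ (fun y =>
      (ContinuousAlternatingMap.ofSubsingletonLIE (𝕜 := ℝ) (E := E) (F := ℝ) (0 : Fin 1)).symm
        (θ y)) x :=
  ((ContinuousAlternatingMap.ofSubsingletonLIE (𝕜 := ℝ) (E := E) (F := ℝ)
    (0 : Fin 1)).symm.toContinuousLinearEquiv.comp_contDiffAt_iff).symm

theorem contDiffAt_oneForm_comp {X : Type*} [NormedAddCommGroup X] [NormedSpace ℝ X]
    {θ : X → E' [⋀^Fin 1]→L[ℝ] ℝ} {A : X → E →L[ℝ] E'} {x : X} (hθ : ContDiffAt ℝ ∞ θ x)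
    (hA : ContDiffAt ℝ ∞ A x) :
    ContDiffAt ℝ ∞ (fun y => (θ y).compContinuousLinearMap (A y)) x := by
  rw [contDiffAt_oneForm_iff] at hθ ⊢
  exact hθ.clm_comp hA

section Charts

variable [IsManifold 𝓘(ℝ, E) ∞ M] [IsManifold 𝓘(ℝ, E') ∞ M']

theorem contMDiffAt_chart {x₀ x : M} (hx : x ∈ (extChartAt 𝓘(ℝ, E) x₀).source) :
    ContMDiffAt 𝓘(ℝ, E) 𝓘(ℝ, E) ∞ (extChartAt 𝓘(ℝ, E) x₀) x :=
  contMDiffAt_extChartAt' (by simpa using hx)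

theorem contMDiffAt_chart_symm {x₀ : M} {y : E} (hy : y ∈ (extChartAt 𝓘(ℝ, E) x₀).target) :
    ContMDiffAt 𝓘(ℝ, E) 𝓘(ℝ, E) ∞ (extChartAt 𝓘(ℝ, E) x₀).symm y :=
  (contMDiffOn_extChartAt_symm x₀).contMDiffAt ((isOpen_extChartAt_target x₀).mem_nhds hy)

theorem contDiffAt_inCharts {F : M → M'} {x₀ : M} {x₀' : M'} {y : E}
    (hy : y ∈ (extChartAt 𝓘(ℝ, E) x₀).target)
    (hF : ContMDiffAt 𝓘(ℝ, E) 𝓘(ℝ, E') ∞ F ((extChartAt 𝓘(ℝ, E) x₀).symm y))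
    (hs : F ((extChartAt 𝓘(ℝ, E) x₀).symm y) ∈ (extChartAt 𝓘(ℝ, E') x₀').source) :
    ContDiffAt ℝ ∞ (extChartAt 𝓘(ℝ, E') x₀' ∘ F ∘ (extChartAt 𝓘(ℝ, E) x₀).symm) y := by
  rw [← contMDiffAt_iff_contDiffAt]
  exact (contMDiffAt_chart hs).comp y (hF.comp y (contMDiffAt_chart_symm hy))

/-- Near $y$ the map stays in the source of the target chart, so that chart and its inverse can be
inserted and the chain rule applied. The identity holds on a neighbourhood because both sides are to
be differentiated. -/
theorem inChart_pullback {p : ℕ} {F : M → M'} {x₀ : M} {x₀' : M'} {y : E} (θ : DForm E' M' p)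
    (hy : y ∈ (extChartAt 𝓘(ℝ, E) x₀).target)
    (hF : ContMDiffAt 𝓘(ℝ, E) 𝓘(ℝ, E') ∞ F ((extChartAt 𝓘(ℝ, E) x₀).symm y))
    (hs : F ((extChartAt 𝓘(ℝ, E) x₀).symm y) ∈ (extChartAt 𝓘(ℝ, E') x₀').source) :
    inChart x₀ (pullback (E := E) F θ) =ᶠ[𝓝 y] fun z =>
      (inChart x₀' θ
        ((extChartAt 𝓘(ℝ, E') x₀' ∘ F ∘ (extChartAt 𝓘(ℝ, E) x₀).symm) z)).compContinuousLinearMap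
      (fderiv ℝ (extChartAt 𝓘(ℝ, E') x₀' ∘ F ∘ (extChartAt 𝓘(ℝ, E) x₀).symm) z) := by
  have hcs := contMDiffAt_chart_symm hy
  have e1 := (contDiffAt_inCharts hy hF hs)
  have e2 : ∀ᶠ z in 𝓝 y, ContDiffAt ℝ 1
      (extChartAt 𝓘(ℝ, E') x₀' ∘ F ∘ (extChartAt 𝓘(ℝ, E) x₀).symm) z :=
    (e1.of_le (m := 1) (by simp)).eventually (by simp)
  have e3 := hcs.continuousAt.eventually (eventually_mdifferentiableAt hF)
  have e4 : ∀ᶠ z in 𝓝 y, F ((extChartAt 𝓘(ℝ, E) x₀).symm z) ∈ (extChartAt 𝓘(ℝ, E') x₀').source :=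
    (ContinuousAt.comp (f := (extChartAt 𝓘(ℝ, E) x₀).symm) hF.continuousAt
      hcs.continuousAt).eventually ((isOpen_extChartAt_source x₀').mem_nhds hs)
  filter_upwards [e2, e3, e4.eventually_nhds, (isOpen_extChartAt_target x₀).mem_nhds hy]
    with z hz2 hz3 hz4 hz5
  have hzs : (extChartAt 𝓘(ℝ, E') x₀').symm
      ((extChartAt 𝓘(ℝ, E') x₀' ∘ F ∘ (extChartAt 𝓘(ℝ, E) x₀).symm) z)
      = F ((extChartAt 𝓘(ℝ, E) x₀).symm z) :=
    (extChartAt 𝓘(ℝ, E') x₀').left_inv hz4.self_of_nhds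
  have hG := (hz2.differentiableAt (by simp)).mdifferentiableAt
  have hs' : MDifferentiableAt 𝓘(ℝ, E') 𝓘(ℝ, E') (extChartAt 𝓘(ℝ, E') x₀').symm
      ((extChartAt 𝓘(ℝ, E') x₀' ∘ F ∘ (extChartAt 𝓘(ℝ, E) x₀).symm) z) :=
    (contMDiffAt_chart_symm ((extChartAt 𝓘(ℝ, E') x₀').map_source
      hz4.self_of_nhds)).mdifferentiableAt (by simp)
  have hcz := (contMDiffAt_chart_symm hz5).mdifferentiableAt (by simp)
  have hev : (extChartAt 𝓘(ℝ, E') x₀').symm ∘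
      (extChartAt 𝓘(ℝ, E') x₀' ∘ F ∘ (extChartAt 𝓘(ℝ, E) x₀).symm)
      =ᶠ[𝓝 z] F ∘ (extChartAt 𝓘(ℝ, E) x₀).symm := by
    filter_upwards [hz4] with w hw
    exact (extChartAt 𝓘(ℝ, E') x₀').left_inv hw
  have hd := diffAt_congr (E := E) (E' := E') hev
  rw [diffAt_comp hs' hG, diffAt_comp hz3 hcz] at hd
  have hfd : diffAt (extChartAt 𝓘(ℝ, E') x₀' ∘ F ∘ (extChartAt 𝓘(ℝ, E) x₀).symm) z
    = fderiv ℝ (extChartAt 𝓘(ℝ, E') x₀' ∘ F ∘ (extChartAt 𝓘(ℝ, E) x₀).symm) z :=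
    mfderiv_eq_fderiv
  rw [hfd] at hd
  simp only [inChart, pullback]
  rw [hzs]
  ext v
  have hd' : ∀ w, diffAt (E := E') (E' := E') (extChartAt 𝓘(ℝ, E') x₀').symm
      ((extChartAt 𝓘(ℝ, E') x₀' ∘ F ∘ (extChartAt 𝓘(ℝ, E) x₀).symm) z)
      (fderiv ℝ (extChartAt 𝓘(ℝ, E') x₀' ∘ F ∘ (extChartAt 𝓘(ℝ, E) x₀).symm) z w)
      = diffAt F ((extChartAt 𝓘(ℝ, E) x₀).symm z)
        (diffAt (extChartAt 𝓘(ℝ, E) x₀).symm z w) := fun w =>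
    congrArg (fun T => T w) hd
  simp only [ContinuousAlternatingMap.compContinuousLinearMap_apply, Function.comp_def] at hd' ⊢
  simp only [hd']

/-- The exterior derivative commutes with pullbacks. -/
theorem extD_pullback {p : ℕ} {θ : DForm E' M' p} (hθ : IsSmooth θ) {F : M → M'} {x : M}
    (hF : ContMDiffAt 𝓘(ℝ, E) 𝓘(ℝ, E') ∞ F x) :
    extD (pullback (E := E) F θ) x = pullback F (extD θ) x := by
  have hx := mem_extChartAt_source (I := 𝓘(ℝ, E)) x
  have hFx := mem_extChartAt_source (I := 𝓘(ℝ, E')) (F x)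
  have hy := mem_extChartAt_target (I := 𝓘(ℝ, E)) x
  have hxx : (extChartAt 𝓘(ℝ, E) x).symm (extChartAt 𝓘(ℝ, E) x x) = x := extChartAt_to_inv x
  have hF' : ContMDiffAt 𝓘(ℝ, E) 𝓘(ℝ, E') ∞ F
      ((extChartAt 𝓘(ℝ, E) x).symm (extChartAt 𝓘(ℝ, E) x x)) := by rwa [hxx]
  have hs : F ((extChartAt 𝓘(ℝ, E) x).symm (extChartAt 𝓘(ℝ, E) x x))
      ∈ (extChartAt 𝓘(ℝ, E') (F x)).source := by rwa [hxx]
  have hG : (extChartAt 𝓘(ℝ, E') (F x) ∘ F ∘ (extChartAt 𝓘(ℝ, E) x).symm)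
      (extChartAt 𝓘(ℝ, E) x x) = extChartAt 𝓘(ℝ, E') (F x) (F x) := by
    simp
  have hsm := contDiffAt_inCharts hy hF' hs
  -- With this chain rule the remaining claim is naturality of `extDeriv` between normed spaces,
  -- applied to the expression of $F$ in the charts.
  have hchain : (fderiv ℝ (extChartAt 𝓘(ℝ, E') (F x) ∘ F ∘ (extChartAt 𝓘(ℝ, E) x).symm)
      (extChartAt 𝓘(ℝ, E) x x)).comp (diffAt (extChartAt 𝓘(ℝ, E) x) x)
      = (diffAt (E := E') (E' := E') (extChartAt 𝓘(ℝ, E') (F x)) (F x)).comp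
        (diffAt (E := E) (E' := E') F x) := by
    have hfd : diffAt (extChartAt 𝓘(ℝ, E') (F x) ∘ F ∘ (extChartAt 𝓘(ℝ, E) x).symm)
        (extChartAt 𝓘(ℝ, E) x x)
      = fderiv ℝ (extChartAt 𝓘(ℝ, E') (F x) ∘ F ∘ (extChartAt 𝓘(ℝ, E) x).symm)
        (extChartAt 𝓘(ℝ, E) x x) := mfderiv_eq_fderiv
    rw [← hfd, ← diffAt_comp (hsm.differentiableAt (by simp)).mdifferentiableAt
      ((contMDiffAt_chart hx).mdifferentiableAt (by simp)),
      ← diffAt_comp ((contMDiffAt_chart hFx).mdifferentiableAt (by simp))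
        (hF.mdifferentiableAt (by simp))]
    apply diffAt_congr
    filter_upwards [(isOpen_extChartAt_source x).mem_nhds hx] with z hz
    simp only [Function.comp_apply, (extChartAt 𝓘(ℝ, E) x).left_inv hz]
  have hext := (inChart_pullback θ hy hF' hs).extDeriv_eq
  rw [extDeriv_pullback (r := ∞) (hG ▸ hθ.differentiableAt (mem_extChartAt_target (F x))) hsm
    (minSmoothness_of_isRCLikeNormedField.trans_le (WithTop.coe_le_coe.2 le_top)), hG] at hext
  simp only [extD, pullback, hext]
  ext v
  simp only [ContinuousAlternatingMap.compContinuousLinearMap_apply]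
  congr 1
  funext i
  exact congrArg (fun T => T (v i)) hchain

theorem contDiffAt_inChart_pullback {F : M → M'} {x₀ : M} {y : E} {θ : DForm E' M' 1}
    (hθ : IsSmooth θ) (hy : y ∈ (extChartAt 𝓘(ℝ, E) x₀).target)
    (hF : ContMDiffAt 𝓘(ℝ, E) 𝓘(ℝ, E') ∞ F ((extChartAt 𝓘(ℝ, E) x₀).symm y)) :
    ContDiffAt ℝ ∞ (inChart x₀ (pullback (E := E) F θ)) y := by
  have hs := mem_extChartAt_source (I := 𝓘(ℝ, E')) (F ((extChartAt 𝓘(ℝ, E) x₀).symm y))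
  refine ContDiffAt.congr_of_eventuallyEq ?_ (inChart_pullback θ hy hF hs)
  have hG := contDiffAt_inCharts hy hF hs
  refine contDiffAt_oneForm_comp ((hθ.contDiffAt ?_).comp y hG) (hG.fderiv_right (by simp))
  exact mem_extChartAt_target (I := 𝓘(ℝ, E')) _

theorem isSmooth_pullback {F : M → M'} {θ : DForm E' M' 1} (hθ : IsSmooth θ)
    (hF : ContMDiff 𝓘(ℝ, E) 𝓘(ℝ, E') ∞ F) : IsSmooth (pullback (E := E) F θ) := fun _ _ hy =>
  (contDiffAt_inChart_pullback hθ hy (hF _)).contDiffWithinAt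

end Charts

section ModelSpace

variable {p : ℕ}

/-- The preferred chart of a normed space is the identity. -/
theorem inChart_self (x : E) (θ : DForm E E p) : inChart x θ = θ := by
  funext y
  have h : diffAt (E := E) (E' := E) (extChartAt 𝓘(ℝ, E) x).symm y = ContinuousLinearMap.id ℝ E := by
    rw [extChartAt_model_space_eq_id]
    exact mfderiv_id
  simp only [inChart, pullback, h]
  simp only [extChartAt_model_space_eq_id]
  rfl

theorem extD_self (x : E) (θ : DForm E E p) : extD θ x = extDeriv θ x := by
  have h : diffAt (E := E) (E' := E) (extChartAt 𝓘(ℝ, E) x) x = ContinuousLinearMap.id ℝ E := by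
    rw [extChartAt_model_space_eq_id]
    exact mfderiv_id
  simp only [extD, inChart_self, h]
  simp only [extChartAt_model_space_eq_id]
  rfl

end ModelSpace

end Calculus

/-! ### Wedge products and Leibniz rules. -/

section Wedge

open Filter Topology

variable {E : Type*} [NormedAddCommGroup E] [NormedSpace ℝ E]
  {M : Type*} [TopologicalSpace M] [ChartedSpace E M]
  {E' : Type*} [NormedAddCommGroup E'] [NormedSpace ℝ E']
  {M' : Type*} [TopologicalSpace M'] [ChartedSpace E' M']

theorem alternating_one_ext {a b : E [⋀^Fin 1]→L[ℝ] ℝ} (h : ∀ u, a ![u] = b ![u]) : a = b := by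
  ext v
  rw [← List.ofFn_inj.1 (by simp : List.ofFn ![v 0] = List.ofFn v)]
  exact h _

theorem alternating_two_ext {a b : E [⋀^Fin 2]→L[ℝ] ℝ} (h : ∀ u v, a ![u, v] = b ![u, v]) :
    a = b := by
  ext v
  rw [← List.ofFn_inj.1 (by simp : List.ofFn ![v 0, v 1] = List.ofFn v)]
  exact h _ _

theorem alternating_three_ext {a b : E [⋀^Fin 3]→L[ℝ] ℝ}
    (h : ∀ u v w, a ![u, v, w] = b ![u, v, w]) : a = b := by
  ext v
  rw [← List.ofFn_inj.1 (by simp : List.ofFn ![v 0, v 1, v 2] = List.ofFn v)]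
  exact h _ _ _

theorem ofSubsingleton_symm_apply (a : E [⋀^Fin 1]→L[ℝ] ℝ) (w : E) :
    (ContinuousAlternatingMap.ofSubsingleton ℝ E ℝ (0 : Fin 1)).symm a w = a ![w] := by
  change a (fun _ => w) = a ![w]
  congr 1
  funext i
  fin_cases i
  rfl

theorem wedgeAlt_apply {p : ℕ} (a : E [⋀^Fin 1]→L[ℝ] ℝ) (b : E [⋀^Fin p]→L[ℝ] ℝ)
    (v : Fin (p + 1) → E) :
    wedgeAlt a b v = ∑ i : Fin (p + 1), (-1) ^ (i : ℕ) * (a ![v i] * b (i.removeNth v)) := by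
  simp only [wedgeAlt, ContinuousAlternatingMap.alternatizeUncurryFin_apply,
    ContinuousLinearMap.smulRight_apply, ContinuousAlternatingMap.smul_apply, smul_eq_mul]
  refine Finset.sum_congr rfl fun i _ => ?_
  simp only [zsmul_eq_mul, Int.cast_pow, Int.cast_neg, Int.cast_one]
  rw [ofSubsingleton_symm_apply]

theorem wedgeAlt_one_apply (a b : E [⋀^Fin 1]→L[ℝ] ℝ) (u v : E) :
    wedgeAlt a b ![u, v] = a ![u] * b ![v] - a ![v] * b ![u] := by
  have h0 : (0 : Fin 2).removeNth ![u, v] = ![v] := by ext i; fin_cases i; rfl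
  have h1 : (1 : Fin 2).removeNth ![u, v] = ![u] := by ext i; fin_cases i; rfl
  rw [wedgeAlt_apply, Fin.sum_univ_two, h0, h1]
  simp
  ring

theorem removeNth_zero_three {X : Type*} (u v w : X) : (0 : Fin 3).removeNth ![u, v, w] = ![v, w] := by
  ext i; fin_cases i <;> rfl
theorem removeNth_one_three {X : Type*} (u v w : X) : (1 : Fin 3).removeNth ![u, v, w] = ![u, w] := by
  ext i; fin_cases i <;> rfl
theorem removeNth_two_three {X : Type*} (u v w : X) : (2 : Fin 3).removeNth ![u, v, w] = ![u, v] := by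
  ext i; fin_cases i <;> rfl

theorem wedgeAlt_two_apply (a : E [⋀^Fin 1]→L[ℝ] ℝ) (b : E [⋀^Fin 2]→L[ℝ] ℝ) (u v w : E) :
    wedgeAlt a b ![u, v, w] = a ![u] * b ![v, w] - a ![v] * b ![u, w] + a ![w] * b ![u, v] := by
  rw [wedgeAlt_apply, Fin.sum_univ_three, removeNth_zero_three, removeNth_one_three,
    removeNth_two_three]
  simp
  ring

theorem wedgeAlt_comp {p : ℕ} (a : E' [⋀^Fin 1]→L[ℝ] ℝ) (b : E' [⋀^Fin p]→L[ℝ] ℝ)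
    (A : E →L[ℝ] E') :
    (wedgeAlt a b).compContinuousLinearMap A
      = wedgeAlt (a.compContinuousLinearMap A) (b.compContinuousLinearMap A) := by
  ext v
  simp only [ContinuousAlternatingMap.compContinuousLinearMap_apply, wedgeAlt_apply]
  refine Finset.sum_congr rfl fun i _ => ?_
  congr 2
  congr 1
  funext j
  fin_cases j
  rfl

theorem pullback_wedge {p : ℕ} (F : M → M') (a : DForm E' M' 1) (b : DForm E' M' p) :
    pullback (E := E) F (wedge a b) = wedge (pullback F a) (pullback F b) := by
  funext x
  exact wedgeAlt_comp _ _ _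

theorem inChart_wedge {p : ℕ} (x₀ : M) (a : DForm E M 1) (b : DForm E M p) :
    inChart x₀ (wedge a b) = fun y => wedgeAlt (inChart x₀ a y) (inChart x₀ b y) :=
  pullback_wedge _ _ _

theorem contDiffAt_wedgeAlt {X : Type*} [NormedAddCommGroup X] [NormedSpace ℝ X] {p : ℕ}
    {a : X → E [⋀^Fin 1]→L[ℝ] ℝ} {b : X → E [⋀^Fin p]→L[ℝ] ℝ} {x : X} (ha : ContDiffAt ℝ ∞ a x)
    (hb : ContDiffAt ℝ ∞ b x) : ContDiffAt ℝ ∞ (fun y => wedgeAlt (a y) (b y)) x :=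
  ContDiffAt.comp (g := ContinuousAlternatingMap.alternatizeUncurryFinCLM (n := p) ℝ E ℝ)
    (f := fun y => ((ContinuousAlternatingMap.ofSubsingleton ℝ E ℝ (0 : Fin 1)).symm
      (a y)).smulRight (b y)) x
    (ContinuousLinearMap.contDiff _).contDiffAt ((contDiffAt_oneForm_iff.1 ha).smulRight hb)

theorem IsSmooth.wedge {p : ℕ} {a : DForm E M 1} {b : DForm E M p} (ha : IsSmooth a)
    (hb : IsSmooth b) : IsSmooth (wedge a b) := by
  intro x₀ y hy
  rw [inChart_wedge]
  exact (contDiffAt_wedgeAlt (ha.contDiffAt hy) (hb.contDiffAt hy)).contDiffWithinAt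

theorem IsSmooth.add {p : ℕ} {a b : DForm E M p} (ha : IsSmooth a)
    (hb : IsSmooth b) : IsSmooth (a + b) := fun x₀ => (ha x₀).add (hb x₀)

theorem IsSmooth.const_smul {p : ℕ} {a : DForm E M p} (ha : IsSmooth a) (c : ℝ) :
    IsSmooth (c • a) := fun x₀ => (ha x₀).const_smul c

theorem extD_add {p : ℕ} {a b : DForm E M p} (ha : IsSmooth a) (hb : IsSmooth b) :
    extD (a + b) = extD a + extD b := by
  funext x
  have h := extDeriv_add (ha.differentiableAt (mem_extChartAt_target (I := 𝓘(ℝ, E)) x))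
    (hb.differentiableAt (mem_extChartAt_target (I := 𝓘(ℝ, E)) x))
  have h' : inChart x (a + b) = inChart x a + inChart x b := rfl
  simp only [extD, h', h, Pi.add_apply]
  rfl

theorem extD_const_smul {p : ℕ} (c : ℝ) (a : DForm E M p) : extD (c • a) = c • extD a := by
  funext x
  have h := extDeriv_smul c (inChart x a) (x := extChartAt 𝓘(ℝ, E) x x)
  have h' : inChart x (c • a) = c • inChart x a := rfl
  simp only [extD, h', h, Pi.smul_apply]
  rfl

theorem extDeriv_one_apply {a : E → E [⋀^Fin 1]→L[ℝ] ℝ} {x : E} (ha : DifferentiableAt ℝ a x)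
    (u v : E) : extDeriv a x ![u, v]
      = fderiv ℝ (fun y => a y ![v]) x u - fderiv ℝ (fun y => a y ![u]) x v := by
  have h0 : (0 : Fin 2).removeNth ![u, v] = ![v] := by ext i; fin_cases i; rfl
  have h1 : (1 : Fin 2).removeNth ![u, v] = ![u] := by ext i; fin_cases i; rfl
  rw [extDeriv_apply ha, Fin.sum_univ_two, h0, h1]
  simp [sub_eq_add_neg]

theorem differentiableAt_form_apply {X : Type*} [NormedAddCommGroup X] [NormedSpace ℝ X] {p : ℕ}
    {a : X → E [⋀^Fin p]→L[ℝ] ℝ} {x : X} (ha : DifferentiableAt ℝ a x) (v : Fin p → E) :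
    DifferentiableAt ℝ (fun y => a y v) x :=
  (ContinuousAlternatingMap.apply ℝ E ℝ v).differentiableAt.comp x ha

/-- The usual $da\wedge b-a\wedge db$. Only wedges with a 1-form on the left are available, and
$da\wedge b=b\wedge da$ because $da$ has even degree. -/
theorem extDeriv_wedgeAlt {a b : E → E [⋀^Fin 1]→L[ℝ] ℝ} {x : E} (ha : ContDiffAt ℝ ∞ a x)
    (hb : ContDiffAt ℝ ∞ b x) :
    extDeriv (fun y => wedgeAlt (a y) (b y)) x
      = wedgeAlt (b x) (extDeriv a x) - wedgeAlt (a x) (extDeriv b x) := by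
  have hd := (contDiffAt_wedgeAlt ha hb).differentiableAt (by simp)
  have ha' := ha.differentiableAt (by simp)
  have hb' := hb.differentiableAt (by simp)
  have key : ∀ u v w : E, fderiv ℝ (fun y => wedgeAlt (a y) (b y) ![v, w]) x u =
      (a x ![v] * fderiv ℝ (fun y => b y ![w]) x u + fderiv ℝ (fun y => a y ![v]) x u * b x ![w])
      - (a x ![w] * fderiv ℝ (fun y => b y ![v]) x u
        + fderiv ℝ (fun y => a y ![w]) x u * b x ![v]) := by
    intro u v w
    simp only [wedgeAlt_one_apply]
    have dA := fun v => (differentiableAt_form_apply ha' ![v]).hasFDerivAt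
    have dB := fun v => (differentiableAt_form_apply hb' ![v]).hasFDerivAt
    refine (congrArg (fun T => T u) (((dA v).mul (dB w)).sub ((dA w).mul (dB v))).fderiv).trans ?_
    simp
    ring
  refine alternating_three_ext fun u v w => ?_
  rw [extDeriv_apply hd, Fin.sum_univ_three, removeNth_zero_three, removeNth_one_three,
    removeNth_two_three]
  simp only [ContinuousAlternatingMap.sub_apply, wedgeAlt_two_apply, extDeriv_one_apply ha',
    extDeriv_one_apply hb', key, Matrix.cons_val_zero, Matrix.cons_val_one, Matrix.cons_val]
  simp
  ring

theorem extDeriv_smul_fun {p : ℕ} {f : E → ℝ} {a : E → E [⋀^Fin p]→L[ℝ] ℝ} {x : E}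
    (hf : DifferentiableAt ℝ f x) (ha : DifferentiableAt ℝ a x) :
    extDeriv (fun y => f y • a y) x
      = wedgeAlt (ContinuousAlternatingMap.ofSubsingleton ℝ E ℝ (0 : Fin 1) (fderiv ℝ f x)) (a x)
        + f x • extDeriv a x := by
  refine (congrArg ContinuousAlternatingMap.alternatizeUncurryFin
    (hf.hasFDerivAt.smul ha.hasFDerivAt).fderiv).trans ?_
  rw [ContinuousAlternatingMap.alternatizeUncurryFin_add,
    ContinuousAlternatingMap.alternatizeUncurryFin_smul]
  exact add_comm _ _

section Charts

variable [IsManifold 𝓘(ℝ, E) ∞ M] [IsManifold 𝓘(ℝ, E') ∞ M']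

/-- Going to the chart and back is locally the identity. This recovers the undifferentiated factors
when a Leibniz rule is transferred from the chart to the manifold. -/
theorem inChart_comp_chart {p : ℕ} (θ : DForm E M p) (x : M) :
    (inChart x θ (extChartAt 𝓘(ℝ, E) x x)).compContinuousLinearMap
      (diffAt (extChartAt 𝓘(ℝ, E) x) x) = θ x := by
  have hx := mem_extChartAt_source (I := 𝓘(ℝ, E)) x
  have h := pullback_pullback_apply (E := E) (E' := E) (E'' := E)
    ((contMDiffAt_chart_symm (mem_extChartAt_target (I := 𝓘(ℝ, E)) x)).mdifferentiableAt (by simp))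
    ((contMDiffAt_chart hx).mdifferentiableAt (by simp)) θ
  have hev : (extChartAt 𝓘(ℝ, E) x).symm ∘ extChartAt 𝓘(ℝ, E) x =ᶠ[𝓝 x] id := by
    filter_upwards [(isOpen_extChartAt_source x).mem_nhds hx] with z hz
    exact (extChartAt 𝓘(ℝ, E) x).left_inv hz
  rw [pullback_congr hev] at h
  have hid : diffAt (E := E) (E' := E) (id : M → M) x = ContinuousLinearMap.id ℝ E := mfderiv_id
  refine h.trans ?_
  simp only [pullback, hid]
  rfl

/-- The differential of a function, as a `1`-form. -/
def dFun (f : M → ℝ) : DForm E M 1 := fun x =>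
  ContinuousAlternatingMap.ofSubsingleton ℝ E ℝ (0 : Fin 1) (diffAt f x)

theorem extD_wedge {a b : DForm E M 1} (ha : IsSmooth a) (hb : IsSmooth b) :
    extD (wedge a b) = wedge b (extD a) - wedge a (extD b) := by
  funext x
  have hy := mem_extChartAt_target (I := 𝓘(ℝ, E)) x
  have h := congrArg (fun T => T.compContinuousLinearMap
      (diffAt (E := E) (E' := E) (extChartAt 𝓘(ℝ, E) x) x))
    (extDeriv_wedgeAlt (ha.contDiffAt hy) (hb.contDiffAt hy))
  rw [← inChart_wedge] at h
  refine h.trans ?_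
  rw [show ∀ (A B : E [⋀^Fin 3]→L[ℝ] ℝ) (T : E →L[ℝ] E), (A - B).compContinuousLinearMap T
    = A.compContinuousLinearMap T - B.compContinuousLinearMap T from fun _ _ _ => rfl,
    wedgeAlt_comp, wedgeAlt_comp, inChart_comp_chart, inChart_comp_chart]
  rfl

theorem extD_smul_fun {p : ℕ} {f : M → ℝ} (hf : ContMDiff 𝓘(ℝ, E) 𝓘(ℝ, ℝ) ∞ f)
    {a : DForm E M p} (ha : IsSmooth a) :
    extD (fun x => f x • a x) = wedge (dFun f) a + fun x => f x • extD a x := by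
  funext x
  have hy := mem_extChartAt_target (I := 𝓘(ℝ, E)) x
  have hxx : (extChartAt 𝓘(ℝ, E) x).symm (extChartAt 𝓘(ℝ, E) x x) = x := extChartAt_to_inv x
  have hfc : DifferentiableAt ℝ (f ∘ (extChartAt 𝓘(ℝ, E) x).symm) (extChartAt 𝓘(ℝ, E) x x) := by
    rw [← mdifferentiableAt_iff_differentiableAt]
    exact (hf.mdifferentiable (by simp) _).comp _
      ((contMDiffAt_chart_symm hy).mdifferentiableAt (by simp))
  have h := congrArg (fun T => T.compContinuousLinearMap
      (diffAt (E := E) (E' := E) (extChartAt 𝓘(ℝ, E) x) x))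
    (extDeriv_smul_fun hfc (ha.differentiableAt hy))
  refine h.trans ?_
  rw [show ∀ (A B : E [⋀^Fin (p + 1)]→L[ℝ] ℝ) (T : E →L[ℝ] E), (A + B).compContinuousLinearMap T
    = A.compContinuousLinearMap T + B.compContinuousLinearMap T from fun _ _ _ => rfl,
    wedgeAlt_comp, inChart_comp_chart]
  have hd : (ContinuousAlternatingMap.ofSubsingleton ℝ E ℝ (0 : Fin 1)
      (fderiv ℝ (f ∘ (extChartAt 𝓘(ℝ, E) x).symm) (extChartAt 𝓘(ℝ, E) x x))).compContinuousLinearMap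
      (diffAt (E := E) (E' := E) (extChartAt 𝓘(ℝ, E) x) x) = dFun f x := by
    have h1 := diffAt_comp (E := E) (E' := E) (E'' := ℝ) (x := x) hfc.mdifferentiableAt
      ((contMDiffAt_chart (mem_extChartAt_source (I := 𝓘(ℝ, E)) x)).mdifferentiableAt (by simp))
    have hev : (f ∘ (extChartAt 𝓘(ℝ, E) x).symm) ∘ extChartAt 𝓘(ℝ, E) x =ᶠ[𝓝 x] f := by
      filter_upwards [(isOpen_extChartAt_source x).mem_nhds
        (mem_extChartAt_source (I := 𝓘(ℝ, E)) x)] with z hz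
      simp only [Function.comp_apply, (extChartAt 𝓘(ℝ, E) x).left_inv hz]
    rw [diffAt_congr hev] at h1
    have h2 : diffAt (E := E) (E' := ℝ) (f ∘ (extChartAt 𝓘(ℝ, E) x).symm) (extChartAt 𝓘(ℝ, E) x x)
      = fderiv ℝ (f ∘ (extChartAt 𝓘(ℝ, E) x).symm) (extChartAt 𝓘(ℝ, E) x x) := mfderiv_eq_fderiv
    rw [h2] at h1
    simp only [dFun, h1]
    rfl
  rw [hd]
  simp only [Function.comp_apply, hxx]
  rfl

theorem isSmooth_smul_fun {p : ℕ} {f : M → ℝ} (hf : ContMDiff 𝓘(ℝ, E) 𝓘(ℝ, ℝ) ∞ f)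
    {a : DForm E M p} (ha : IsSmooth a) : IsSmooth (fun x => f x • a x) := by
  intro x₀ y hy
  have hfc : ContDiffAt ℝ ∞ (f ∘ (extChartAt 𝓘(ℝ, E) x₀).symm) y := by
    rw [← contMDiffAt_iff_contDiffAt]
    exact (hf _).comp _ (contMDiffAt_chart_symm hy)
  exact (hfc.smul (ha.contDiffAt hy)).contDiffWithinAt

end Charts

end Wedge

/-! ### Coframes with the structure equations, and transport of exactness. -/

section Frames

variable {E : Type*} [NormedAddCommGroup E] [NormedSpace ℝ E]
  {M : Type*} [TopologicalSpace M] [ChartedSpace E M]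

/-- A global smooth coframe `α, β, γ, η` with structure equations `dα = k γ ∧ α`,
`dβ = - k γ ∧ β`, `dγ = 0`, `dη = c α ∧ β`. -/
structure IsSolCoframe (k c : ℝ) (α β γ η : DForm E M 1) : Prop where
  smooth_alpha : IsSmooth α
  smooth_beta : IsSmooth β
  smooth_gamma : IsSmooth γ
  smooth_eta : IsSmooth η
  extD_alpha : extD α = k • wedge γ α
  extD_beta : extD β = (-k) • wedge γ β
  extD_gamma : extD γ = 0
  extD_eta : extD η = c • wedge α β
  exists_vector : ∀ (x : M) (a b c d : ℝ), ∃ v : E,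
    α x ![v] = a ∧ β x ![v] = b ∧ γ x ![v] = c ∧ η x ![v] = d
  eq_zero : ∀ (x : M) (v : E),
    α x ![v] = 0 → β x ![v] = 0 → γ x ![v] = 0 → η x ![v] = 0 → v = 0

theorem wedge_one_apply (a b : DForm E M 1) (x : M) (u v : E) :
    wedge a b x ![u, v] = a x ![u] * b x ![v] - a x ![v] * b x ![u] :=
  wedgeAlt_one_apply _ _ _ _

theorem wedge_two_apply (a : DForm E M 1) (b : DForm E M 2) (x : M) (u v w : E) :
    wedge a b x ![u, v, w]
      = a x ![u] * b x ![v, w] - a x ![v] * b x ![u, w] + a x ![w] * b x ![u, v] :=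
  wedgeAlt_two_apply _ _ _ _ _

theorem form_one_add (a : E [⋀^Fin 1]→L[ℝ] ℝ) (u v : E) : a ![u + v] = a ![u] + a ![v] := by
  have := ((ContinuousAlternatingMap.ofSubsingleton ℝ E ℝ (0 : Fin 1)).symm a).map_add u v
  rwa [ofSubsingleton_symm_apply, ofSubsingleton_symm_apply, ofSubsingleton_symm_apply] at this

theorem form_one_smul (a : E [⋀^Fin 1]→L[ℝ] ℝ) (t : ℝ) (u : E) : a ![t • u] = t * a ![u] := by
  have := ((ContinuousAlternatingMap.ofSubsingleton ℝ E ℝ (0 : Fin 1)).symm a).map_smul t u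
  rwa [ofSubsingleton_symm_apply, ofSubsingleton_symm_apply] at this

theorem form_one_sub (a : E [⋀^Fin 1]→L[ℝ] ℝ) (u v : E) : a ![u - v] = a ![u] - a ![v] := by
  have h := form_one_add a (u - v) v
  rw [sub_add_cancel] at h
  linarith

theorem form_zero_apply {p : ℕ} (v : Fin p → E) : (0 : E [⋀^Fin p]→L[ℝ] ℝ) v = 0 := rfl

theorem OmegaT_apply (k c : ℝ) (α β γ η : DForm E M 1) (t₁ t₂ t₃ : ℝ) (x : M) (u v : E) :
    OmegaT k c α β γ η t₁ t₂ t₃ x ![u, v]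
      = t₁ * (α x ![u] * η x ![v] - α x ![v] * η x ![u])
        + t₂ * (β x ![u] * γ x ![v] - β x ![v] * γ x ![u])
        + t₃ * (c * (α x ![u] * β x ![v] - α x ![v] * β x ![u])
          - k * (γ x ![u] * η x ![v] - γ x ![v] * η x ![u])) := by
  simp only [OmegaT, Pi.add_apply, Pi.smul_apply, Pi.sub_apply, ContinuousAlternatingMap.add_apply,
    ContinuousAlternatingMap.smul_apply, ContinuousAlternatingMap.sub_apply, wedge_one_apply,
    smul_eq_mul]

theorem Omega_eq_OmegaT (k c : ℝ) (α β γ η : DForm E M 1) :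
    Omega k c α β γ η = OmegaT k c α β γ η 0 0 1 := by
  simp [Omega, OmegaT]

theorem wedge_comm_one (a b : DForm E M 1) : wedge a b = -wedge b a := by
  funext x
  refine alternating_two_ext fun u v => ?_
  simp only [Pi.neg_apply, ContinuousAlternatingMap.neg_apply, wedge_one_apply]
  ring

theorem Omega'_eq_Omega (k c : ℝ) (α β γ η : DForm E M 1) :
    Omega' k c α β γ η = Omega (-k) (-c) β α γ η := by
  rw [Omega', Omega, wedge_comm_one β α]
  module

theorem OmegaS_eq_OmegaT (k c : ℝ) (α β γ η : DForm E M 1) (s₁ s₂ s₃ : ℝ) :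
    OmegaS k c α β γ η s₁ s₂ s₃ = OmegaT (-k) (-c) β α γ η s₁ s₂ s₃ := by
  rw [OmegaS, OmegaT, wedge_comm_one β α]
  module

theorem dFun_inv {f : M → ℝ} (hf : ContMDiff 𝓘(ℝ, E) 𝓘(ℝ, ℝ) ∞ f) {x : M} (hx : f x ≠ 0) :
    dFun (E := E) (fun y => (f y)⁻¹) x = -(f x ^ 2)⁻¹ • dFun f x := by
  have h := diffAt_comp (E := E) (E' := ℝ) (E'' := ℝ) (G := fun t : ℝ => t⁻¹) (F := f) (x := x)
    (hasDerivAt_inv hx).differentiableAt.mdifferentiableAt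
    ((hf x).mdifferentiableAt (by simp))
  have h2 : diffAt (E := ℝ) (E' := ℝ) (fun t : ℝ => t⁻¹) (f x) = fderiv ℝ (fun t : ℝ => t⁻¹) (f x) :=
    mfderiv_eq_fderiv
  rw [h2, (hasDerivAt_inv hx).hasFDerivAt.fderiv] at h
  refine alternating_one_ext fun u => ?_
  have h3 := congrArg (fun T => T u) h
  refine h3.trans ?_
  simp [dFun, mul_comm]

namespace IsSolCoframe

variable {k c : ℝ} {α β γ η : DForm E M 1}

/-- Reduces the second family to the first: $\alpha$ and $\beta$ differ by the sign of $k$ in their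
structure equations, and antisymmetry of $\alpha\wedge\beta$ changes the sign of $c$. -/
theorem swap (h : IsSolCoframe k c α β γ η) : IsSolCoframe (-k) (-c) β α γ η where
  smooth_alpha := h.smooth_beta
  smooth_beta := h.smooth_alpha
  smooth_gamma := h.smooth_gamma
  smooth_eta := h.smooth_eta
  extD_alpha := h.extD_beta
  extD_beta := by rw [neg_neg, h.extD_alpha]
  extD_gamma := h.extD_gamma
  extD_eta := by rw [h.extD_eta, wedge_comm_one β α, smul_neg, neg_smul, neg_neg]
  exists_vector x a b c d := by
    obtain ⟨v, h1, h2, h3, h4⟩ := h.exists_vector x b a c d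
    exact ⟨v, h2, h1, h3, h4⟩
  eq_zero x v h1 h2 := h.eq_zero x v h2 h1

theorem smooth_OmegaT (h : IsSolCoframe k c α β γ η) (t₁ t₂ t₃ : ℝ) :
    IsSmooth (OmegaT k c α β γ η t₁ t₂ t₃) := by
  have e : OmegaT k c α β γ η t₁ t₂ t₃ = t₁ • wedge α η + t₂ • wedge β γ
      + t₃ • (c • wedge α β + (-k) • wedge γ η) := by
    rw [OmegaT]; module
  rw [e]
  exact (((h.smooth_alpha.wedge h.smooth_eta).const_smul _).add
    ((h.smooth_beta.wedge h.smooth_gamma).const_smul _)).add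
    ((((h.smooth_alpha.wedge h.smooth_beta).const_smul _).add
      ((h.smooth_gamma.wedge h.smooth_eta).const_smul _)).const_smul _)

theorem omega_nondegenerate (h : IsSolCoframe k c α β γ η) (hk : k ≠ 0) (hc : c ≠ 0) (x : M)
    (v : E) (hv : v ≠ 0) : ∃ u : E, Omega k c α β γ η x ![v, u] ≠ 0 := by
  by_contra! hu
  simp only [Omega_eq_OmegaT, OmegaT_apply] at hu
  obtain ⟨A, A1, A2, A3, A4⟩ := h.exists_vector x 1 0 0 0
  obtain ⟨B, B1, B2, B3, B4⟩ := h.exists_vector x 0 1 0 0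
  obtain ⟨C, C1, C2, C3, C4⟩ := h.exists_vector x 0 0 1 0
  obtain ⟨D, D1, D2, D3, D4⟩ := h.exists_vector x 0 0 0 1
  -- Pairing $v$ with the dual frame isolates its coordinates: $A,B$ see the $\beta$- and
  -- $\alpha$-components with factor $c$, while $C,D$ see the $\eta$- and $\gamma$-components with
  -- factor $k$, up to sign.
  have hA := hu A
  have hB := hu B
  have hC := hu C
  have hD := hu D
  simp only [A1, A2, A3, A4] at hA
  simp only [B1, B2, B3, B4] at hB
  simp only [C1, C2, C3, C4] at hC
  simp only [D1, D2, D3, D4] at hD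
  refine hv (h.eq_zero x v ?_ ?_ ?_ ?_)
  · refine (mul_eq_zero.1 (?_ : c * _ = 0)).resolve_left hc
    linarith
  · refine (mul_eq_zero.1 (?_ : c * _ = 0)).resolve_left hc
    linarith
  · refine (mul_eq_zero.1 (?_ : k * _ = 0)).resolve_left hk
    linarith
  · refine (mul_eq_zero.1 (?_ : k * _ = 0)).resolve_left hk
    linarith

theorem form_eq_zero (h : IsSolCoframe k c α β γ η) {x : M} {A B C D : E}
    (hA : α x ![A] = 1 ∧ β x ![A] = 0 ∧ γ x ![A] = 0 ∧ η x ![A] = 0)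
    (hB : α x ![B] = 0 ∧ β x ![B] = 1 ∧ γ x ![B] = 0 ∧ η x ![B] = 0)
    (hC : α x ![C] = 0 ∧ β x ![C] = 0 ∧ γ x ![C] = 1 ∧ η x ![C] = 0)
    (hD : α x ![D] = 0 ∧ β x ![D] = 0 ∧ γ x ![D] = 0 ∧ η x ![D] = 1)
    {θ : E [⋀^Fin 1]→L[ℝ] ℝ} (h1 : θ ![A] = 0) (h2 : θ ![B] = 0) (h3 : θ ![C] = 0)
    (h4 : θ ![D] = 0) : θ = 0 := by
  refine alternating_one_ext fun v => ?_
  have hv : v - (α x ![v] • A + β x ![v] • B + γ x ![v] • C + η x ![v] • D) = 0 := by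
    apply h.eq_zero x <;> simp only [form_one_sub, form_one_add, form_one_smul, hA, hB, hC, hD] <;>
      ring
  rw [sub_eq_zero.1 hv]
  simp only [form_one_add, form_one_smul, h1, h2, h3, h4]
  simp

/-- The square of $\Theta=\Omega_{(t_1,t_2,t_3)}$ is
$2(t_1t_2-ckt_3^2)\,\alpha\wedge\beta\wedge\gamma\wedge\eta$, so the hypothesis is nondegeneracy,
and in dimension 4 wedging covectors with a nondegenerate 2-form is injective. -/
theorem eq_zero_of_wedgeAlt_OmegaT (h : IsSolCoframe k c α β γ η) {t₁ t₂ t₃ : ℝ}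
    (ht : t₁ * t₂ ≠ c * k * t₃ ^ 2) {x : M} {θ : E [⋀^Fin 1]→L[ℝ] ℝ}
    (hθ : wedgeAlt θ (OmegaT k c α β γ η t₁ t₂ t₃ x) = 0) : θ = 0 := by
  obtain ⟨A, hA⟩ := h.exists_vector x 1 0 0 0
  obtain ⟨B, hB⟩ := h.exists_vector x 0 1 0 0
  obtain ⟨C, hC⟩ := h.exists_vector x 0 0 1 0
  obtain ⟨D, hD⟩ := h.exists_vector x 0 0 0 1
  have key : ∀ u v w, wedgeAlt θ (OmegaT k c α β γ η t₁ t₂ t₃ x) ![u, v, w] = 0 := by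
    intro u v w
    rw [hθ]; rfl
  simp only [wedgeAlt_two_apply, OmegaT_apply] at key
  have e1 := key A B C
  have e2 := key A B D
  have e3 := key A C D
  have e4 := key B C D
  simp only [hA, hB, hC, hD] at e1 e2 e3 e4
  have ht' : t₁ * t₂ - c * k * t₃ ^ 2 ≠ 0 := sub_ne_zero.2 ht
  -- The four equations split into two $2\times2$ systems: `e1`, `e3` for $\theta(A),\theta(C)$ and
  -- `e2`, `e4` for $\theta(B),\theta(D)$. Up to sign each has determinant $t_1t_2-ckt_3^2$, and the
  -- combinations below are Cramer's rule.
  refine h.form_eq_zero hA hB hC hD ?_ ?_ ?_ ?_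
  · refine (mul_eq_zero.1 (?_ : (t₁ * t₂ - c * k * t₃ ^ 2) * _ = 0)).resolve_left ht'
    linear_combination t₁ * e1 + c * t₃ * e3
  · refine (mul_eq_zero.1 (?_ : (t₁ * t₂ - c * k * t₃ ^ 2) * _ = 0)).resolve_left ht'
    linear_combination -t₂ * e2 + c * t₃ * e4
  · refine (mul_eq_zero.1 (?_ : (t₁ * t₂ - c * k * t₃ ^ 2) * _ = 0)).resolve_left ht'
    linear_combination -t₂ * e3 - k * t₃ * e1
  · refine (mul_eq_zero.1 (?_ : (t₁ * t₂ - c * k * t₃ ^ 2) * _ = 0)).resolve_left ht'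
    linear_combination t₁ * e4 - k * t₃ * e2

theorem Omega_eq_lichD (h : IsSolCoframe k c α β γ η) :
    Omega k c α β γ η = lichD (-k • γ) η := by
  rw [lichD, h.extD_eta]
  funext x
  refine alternating_two_ext fun u v => ?_
  simp only [Omega, Pi.add_apply, Pi.smul_apply, Pi.sub_apply, ContinuousAlternatingMap.add_apply,
    ContinuousAlternatingMap.smul_apply, ContinuousAlternatingMap.sub_apply, wedge_one_apply,
    smul_eq_mul]
  ring

variable [IsManifold 𝓘(ℝ, E) ∞ M]

/-- Each of $\alpha\wedge\eta$, $\beta\wedge\gamma$ and $c\,\alpha\wedge\beta-k\,\gamma\wedge\eta$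
satisfies $d\Theta=k\gamma\wedge\Theta$, so all members of the family, including $\Omega$ itself,
share the Lee form $-k\gamma$. -/
theorem extD_OmegaT (h : IsSolCoframe k c α β γ η) (t₁ t₂ t₃ : ℝ) :
    extD (OmegaT k c α β γ η t₁ t₂ t₃) = k • wedge γ (OmegaT k c α β γ η t₁ t₂ t₃) := by
  have e : OmegaT k c α β γ η t₁ t₂ t₃ = t₁ • wedge α η + t₂ • wedge β γ
      + ((t₃ * c) • wedge α β + (-t₃ * k) • wedge γ η) := by
    rw [OmegaT]; module
  have s1 := h.smooth_alpha
  have s2 := h.smooth_beta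
  have s3 := h.smooth_gamma
  have s4 := h.smooth_eta
  rw [e, extD_add (((s1.wedge s4).const_smul _).add ((s2.wedge s3).const_smul _))
    (((s1.wedge s2).const_smul _).add ((s3.wedge s4).const_smul _)),
    extD_add ((s1.wedge s4).const_smul _) ((s2.wedge s3).const_smul _),
    extD_add ((s1.wedge s2).const_smul _) ((s3.wedge s4).const_smul _)]
  simp only [extD_const_smul, extD_wedge s1 s4, extD_wedge s2 s3, extD_wedge s1 s2,
    extD_wedge s3 s4, h.extD_alpha, h.extD_beta, h.extD_gamma, h.extD_eta]
  funext x
  refine alternating_three_ext fun u v w => ?_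
  simp only [Pi.add_apply, Pi.smul_apply, Pi.sub_apply, ContinuousAlternatingMap.add_apply,
    ContinuousAlternatingMap.smul_apply, ContinuousAlternatingMap.sub_apply, wedge_one_apply,
    wedge_two_apply, smul_eq_mul, Pi.zero_apply, form_zero_apply]
  ring

theorem isLCS_Omega (h : IsSolCoframe k c α β γ η) (hk : k ≠ 0) (hc : c ≠ 0) :
    IsLCS (Omega k c α β γ η) (-k • γ) where
  smooth := by rw [Omega_eq_OmegaT]; exact h.smooth_OmegaT _ _ _
  nondegenerate := h.omega_nondegenerate hk hc
  lee_smooth := h.smooth_gamma.const_smul _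
  lee_closed := by rw [extD_const_smul, h.extD_gamma, smul_zero]
  extD_eq := by
    rw [Omega_eq_OmegaT, h.extD_OmegaT]
    funext x
    refine alternating_three_ext fun u v w => ?_
    simp only [Pi.neg_apply, Pi.smul_apply, ContinuousAlternatingMap.neg_apply,
      ContinuousAlternatingMap.smul_apply, wedge_two_apply, smul_eq_mul]
    ring

/-- A diffeomorphism has invertible differentials, so the pullback of the nondegenerate $\Omega$
vanishes at no point. -/
theorem ne_zero_of_pullback_Omega (h : IsSolCoframe k c α β γ η) (hk : k ≠ 0) (hc : c ≠ 0)
    (φ : Diffeomorph 𝓘(ℝ, E) 𝓘(ℝ, E) M M ∞) {r : ℝ} {x : M} {Θ : E [⋀^Fin 2]→L[ℝ] ℝ}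
    (hφ : pullback φ (Omega k c α β γ η) x = r • Θ) : r ≠ 0 := by
  rintro rfl
  rw [zero_smul] at hφ
  obtain ⟨v, hv, -⟩ := h.exists_vector (φ x) 1 0 0 0
  have hv0 : v ≠ 0 := by
    rintro rfl
    have := form_one_smul (α (φ x)) 0 0
    rw [smul_zero, hv] at this
    simp at this
  obtain ⟨u, hu⟩ := h.omega_nondegenerate hk hc (φ x) v hv0
  let L : E ≃L[ℝ] E := φ.mfderivToContinuousLinearEquiv (by simp) x
  have hL : ∀ w : E, diffAt (E := E) (E' := E) φ x (L.symm w) = w := fun w => L.apply_symm_apply w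
  have h0 : pullback φ (Omega k c α β γ η) x (fun i => L.symm (![v, u] i)) = 0 := by
    rw [hφ]; rfl
  refine hu (Eq.trans ?_ h0)
  simp only [pullback, ContinuousAlternatingMap.compContinuousLinearMap_apply]
  exact congrArg _ (funext fun i => (hL _).symm)

/-- If `Ω` is equivalent to `Ω_(t₁, t₂, t₃)` then the latter is exact for the Lichnerowicz
differential of its Lee form `-kγ`. -/
theorem exists_primitive_of_equivalent (h : IsSolCoframe k c α β γ η) (hk : k ≠ 0) (hc : c ≠ 0)
    {t₁ t₂ t₃ : ℝ} (ht : t₁ * t₂ ≠ c * k * t₃ ^ 2)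
    (he : Equivalent (Omega k c α β γ η) (OmegaT k c α β γ η t₁ t₂ t₃)) :
    ∃ ξ : DForm E M 1, IsSmooth ξ ∧
      extD ξ = OmegaT k c α β γ η t₁ t₂ t₃ + k • wedge γ ξ := by
  obtain ⟨φ, f, hf, hφ⟩ := he
  set Θ := OmegaT k c α β γ η t₁ t₂ t₃ with hΘ
  have hf0 : ∀ x, f x ≠ 0 := fun x => h.ne_zero_of_pullback_Omega hk hc φ (hφ x)
  have hφ' : pullback φ (Omega k c α β γ η) = fun x => f x • Θ x := funext hφ
  have hsφ : ContMDiff 𝓘(ℝ, E) 𝓘(ℝ, E) ∞ φ := φ.contMDiff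
  -- This computes $d(f\Theta)$ from the Lee form of $\Omega$; the Leibniz rule with the Lee form of
  -- $\Theta$ gives a second expression.
  have hd : extD (pullback φ (Omega k c α β γ η)) = k • wedge (pullback φ γ) (fun x => f x • Θ x) := by
    funext x
    rw [extD_pullback (Omega_eq_OmegaT k c α β γ η ▸ h.smooth_OmegaT 0 0 1) (hsφ x),
      Omega_eq_OmegaT, h.extD_OmegaT, ← Omega_eq_OmegaT, ← hφ', ← pullback_wedge]
    rfl
  rw [hφ', extD_smul_fun hf (h.smooth_OmegaT _ _ _), h.extD_OmegaT] at hd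
  -- The two expressions differ by $(df-kf(\phi^*\gamma-\gamma))\wedge\Theta$, and wedging with
  -- $\Theta$ is injective on covectors.
  have hdf : ∀ x, dFun f x = (k * f x) • (pullback φ γ x - γ x) := by
    intro x
    rw [← sub_eq_zero]
    refine h.eq_zero_of_wedgeAlt_OmegaT ht (x := x) ?_
    refine alternating_three_ext fun u v w => ?_
    have := congrArg (fun T => T ![u, v, w]) (congrFun hd x)
    simp only [Pi.add_apply, Pi.smul_apply, ContinuousAlternatingMap.add_apply,
      ContinuousAlternatingMap.smul_apply, wedge_two_apply, smul_eq_mul, ← hΘ] at this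
    simp only [wedgeAlt_two_apply, ContinuousAlternatingMap.sub_apply, ← hΘ,
      ContinuousAlternatingMap.smul_apply, smul_eq_mul, form_zero_apply]
    linear_combination this
  have hs : IsSmooth (pullback φ η) := isSmooth_pullback h.smooth_eta hsφ
  have hg : ContMDiff 𝓘(ℝ, E) 𝓘(ℝ, ℝ) ∞ (fun x => (f x)⁻¹) := fun x =>
    (contDiffAt_inv ℝ (hf0 x)).contMDiffAt.comp x (hf x)
  -- The factor $f^{-1}$ is the gauge change between the Lee forms $-k\phi^*\gamma$ and $-k\gamma$:
  -- the term from $d(f^{-1})$ replaces $\phi^*\gamma$ by $\gamma$.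
  refine ⟨fun x => (f x)⁻¹ • pullback φ η x, isSmooth_smul_fun hg hs, ?_⟩
  rw [extD_smul_fun hg hs]
  funext x
  -- This is $d\eta=c\,\alpha\wedge\beta=\Omega+k\,\gamma\wedge\eta$ pulled back by $\phi$.
  have hη : extD (pullback φ η) x = f x • Θ x + k • wedge (pullback φ γ) (pullback φ η) x := by
    rw [extD_pullback h.smooth_eta (hsφ x), h.extD_eta, ← hφ x, ← pullback_wedge]
    simp only [Omega, pullback]
    ext v
    simp
  refine alternating_two_ext fun u v => ?_
  simp only [Pi.add_apply, Pi.smul_apply, ContinuousAlternatingMap.add_apply,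
    ContinuousAlternatingMap.smul_apply, wedge_one_apply, smul_eq_mul, hη, dFun_inv hf (hf0 x), hdf,
    ContinuousAlternatingMap.sub_apply]
  have := hf0 x
  field_simp
  ring

end IsSolCoframe

end Frames

/-! ### Structure equations on $G_k$ and on $G_k/\Gamma$. -/

section QuotientForms

open Filter Topology

variable {k : ℝ}

theorem contDiff_covector {a b c : EuclideanSpace ℝ (Fin 3) → ℝ} (ha : ContDiff ℝ ∞ a)
    (hb : ContDiff ℝ ∞ b) (hc : ContDiff ℝ ∞ c) :
    ContDiff ℝ ∞ (fun g => Gk.covector (a g) (b g) (c g)) :=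
  (ContinuousAlternatingMap.ofSubsingletonLIE (𝕜 := ℝ) (E := EuclideanSpace ℝ (Fin 3)) (F := ℝ)
    (0 : Fin 1)).contDiff.comp
    (((ha.smul contDiff_const).add (hb.smul contDiff_const)).add (hc.smul contDiff_const))

theorem contDiff_coord (i : Fin 3) : ContDiff ℝ ∞ (fun g : EuclideanSpace ℝ (Fin 3) => g i) :=
  (EuclideanSpace.proj (𝕜 := ℝ) i : EuclideanSpace ℝ (Fin 3) →L[ℝ] ℝ).contDiff

theorem contDiff_alpha : ContDiff ℝ ∞ (fun g : EuclideanSpace ℝ (Fin 3) => Gk.alpha k g) :=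
  contDiff_covector contDiff_const contDiff_const ((contDiff_const.mul (contDiff_coord 0)).neg)

theorem contDiff_beta : ContDiff ℝ ∞ (fun g : EuclideanSpace ℝ (Fin 3) => Gk.beta k g) :=
  contDiff_covector contDiff_const contDiff_const (contDiff_const.mul (contDiff_coord 1))

theorem contDiff_gamma : ContDiff ℝ ∞ (fun g : EuclideanSpace ℝ (Fin 3) => Gk.gamma k g) :=
  contDiff_covector contDiff_const contDiff_const contDiff_const

theorem hasFDerivAt_coord (i : Fin 3) (g : EuclideanSpace ℝ (Fin 3)) :
    HasFDerivAt (fun g : EuclideanSpace ℝ (Fin 3) => g i)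
      (EuclideanSpace.proj (𝕜 := ℝ) i : EuclideanSpace ℝ (Fin 3) →L[ℝ] ℝ) g :=
  (EuclideanSpace.proj (𝕜 := ℝ) i : EuclideanSpace ℝ (Fin 3) →L[ℝ] ℝ).hasFDerivAt

/-- Only the $dz$-coefficient varies, and it is linear in one coordinate. The cases $i=0$, $r=-k$
and $i=1$, $r=k$ are $d\alpha$ and $d\beta$. -/
theorem extDeriv_covector {i : Fin 3} {a b r : ℝ} (g u v : EuclideanSpace ℝ (Fin 3)) :
    extDeriv (fun g : EuclideanSpace ℝ (Fin 3) => Gk.covector a b (r * g i)) g ![u, v]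
      = r * (u i * v 2 - v i * u 2) := by
  have hs : ContDiff ℝ ∞ (fun g : EuclideanSpace ℝ (Fin 3) => Gk.covector a b (r * g i)) :=
    contDiff_covector contDiff_const contDiff_const (contDiff_const.mul (contDiff_coord i))
  have hd : ∀ u v : EuclideanSpace ℝ (Fin 3),
      fderiv ℝ (fun g : EuclideanSpace ℝ (Fin 3) => Gk.covector a b (r * g i) ![v]) g u
        = r * u i * v 2 := by
    intro u v
    simp only [Gk.covector_apply]
    have h := (((hasFDerivAt_coord i g).const_mul r).mul_const (v 2)).const_add
      (a * v 0 + b * v 1)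
    refine (congrArg (fun T => T u) h.fderiv).trans ?_
    simp
    ring
  rw [extDeriv_one_apply (hs.differentiable (by simp) g), hd, hd]
  ring

theorem extD_alphaG : extD (Gk.alpha k) = k • wedge (Gk.gamma k) (Gk.alpha k) := by
  funext g
  refine (extD_self (E := EuclideanSpace ℝ (Fin 3)) g (Gk.alpha k)).trans ?_
  have e : (fun g : EuclideanSpace ℝ (Fin 3) => Gk.alpha k g)
      = fun g : EuclideanSpace ℝ (Fin 3) => Gk.covector 1 0 (-k * g 0) :=
    funext fun g => congrArg _ (neg_mul _ _).symm
  refine alternating_two_ext fun u v => ?_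
  refine (congrArg (fun θ => extDeriv (E := EuclideanSpace ℝ (Fin 3)) θ g ![u, v]) e).trans ?_
  refine (extDeriv_covector (g : EuclideanSpace ℝ (Fin 3)) u v).trans ?_
  simp only [Pi.smul_apply, ContinuousAlternatingMap.smul_apply, wedge_one_apply, Gk.gamma,
    Gk.alpha, Gk.covector_apply, Matrix.cons_val_zero, smul_eq_mul]
  ring

theorem extD_betaG : extD (Gk.beta k) = (-k) • wedge (Gk.gamma k) (Gk.beta k) := by
  funext g
  refine (extD_self (E := EuclideanSpace ℝ (Fin 3)) g (Gk.beta k)).trans ?_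
  have e : (fun g : EuclideanSpace ℝ (Fin 3) => Gk.beta k g)
      = fun g : EuclideanSpace ℝ (Fin 3) => Gk.covector 0 1 (k * g 1) := rfl
  refine alternating_two_ext fun u v => ?_
  refine (congrArg (fun θ => extDeriv (E := EuclideanSpace ℝ (Fin 3)) θ g ![u, v]) e).trans ?_
  refine (extDeriv_covector (g : EuclideanSpace ℝ (Fin 3)) u v).trans ?_
  simp only [Pi.smul_apply, ContinuousAlternatingMap.smul_apply, wedge_one_apply, Gk.gamma,
    Gk.beta, Gk.covector_apply, Matrix.cons_val_zero, smul_eq_mul]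
  ring

theorem extD_gammaG : extD (Gk.gamma k) = 0 := by
  funext g
  refine (extD_self (E := EuclideanSpace ℝ (Fin 3)) g (Gk.gamma k)).trans ?_
  refine alternating_two_ext fun u v => ?_
  have hc : extDeriv (E := EuclideanSpace ℝ (Fin 3))
      (fun _ : EuclideanSpace ℝ (Fin 3) => Gk.covector 0 0 1) g = 0 := by
    refine (congrArg ContinuousAlternatingMap.alternatizeUncurryFin
      (fderiv_const_apply (Gk.covector 0 0 1))).trans ?_
    exact map_zero (ContinuousAlternatingMap.alternatizeUncurryFinCLM ℝ _ ℝ)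
  exact congrArg (fun T => T ![u, v]) hc

variable (Γ : Subgroup (Gk k)) [DiscreteTopology Γ]

theorem contMDiff_mk : ContMDiff 𝓘(ℝ, EuclideanSpace ℝ (Fin 3)) 𝓘(ℝ, EuclideanSpace ℝ (Fin 3)) ∞
    (QuotientGroup.mk : Gk k → Gk k ⧸ Γ) :=
  (isLocalDiffeomorph_mk Γ).contMDiff

/-- Charts of the quotient are local inverses of the projection, so every inverse chart is the
projection itself. Smoothness on the quotient can therefore be read off on $G_k$. -/
theorem inChart_eq_pullback_mk {p : ℕ} (q : Gk k ⧸ Γ)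
    (θ : DForm (EuclideanSpace ℝ (Fin 3)) (Gk k ⧸ Γ) p) :
    inChart q θ
      = pullback (E := EuclideanSpace ℝ (Fin 3)) (QuotientGroup.mk : Gk k → Gk k ⧸ Γ) θ := by
  have h : ∀ g : Gk k, (extChartAt 𝓘(ℝ, EuclideanSpace ℝ (Fin 3)) q).symm g
      = (QuotientGroup.mk g : Gk k ⧸ Γ) := fun g =>
    congrFun ((isLocalHomeomorph_mk Γ).localInverseAt_symm (x := q.out)) g
  exact congrArg (fun F : Gk k → Gk k ⧸ Γ => pullback (E := EuclideanSpace ℝ (Fin 3)) F θ)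
    (funext h)

theorem isSmooth_of_pullback_mk {p : ℕ} {θ : DForm (EuclideanSpace ℝ (Fin 3)) (Gk k ⧸ Γ) p}
    {θ' : DForm (EuclideanSpace ℝ (Fin 3)) (Gk k) p}
    (h : pullback (E := EuclideanSpace ℝ (Fin 3)) (QuotientGroup.mk : Gk k → Gk k ⧸ Γ) θ = θ')
    (hθ : ContDiff ℝ ∞ (fun g : EuclideanSpace ℝ (Fin 3) => θ' g)) : IsSmooth θ := by
  intro q
  rw [inChart_eq_pullback_mk, h]
  exact hθ.contDiffOn

theorem isSmooth_alphaN : IsSmooth (alphaN Γ) :=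
  isSmooth_of_pullback_mk Γ (pullback_mk_alphaN Γ) contDiff_alpha
theorem isSmooth_betaN : IsSmooth (betaN Γ) :=
  isSmooth_of_pullback_mk Γ (pullback_mk_betaN Γ) contDiff_beta
theorem isSmooth_gammaN : IsSmooth (gammaN Γ) :=
  isSmooth_of_pullback_mk Γ (pullback_mk_gammaN Γ) contDiff_gamma

/-- The differential of the projection `G_k → G_k / Γ` is invertible. -/
def diffMk (g : Gk k) : EuclideanSpace ℝ (Fin 3) ≃L[ℝ] EuclideanSpace ℝ (Fin 3) :=
  (isLocalDiffeomorph_mk Γ).mfderivToContinuousLinearEquiv (by simp) g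

theorem diffMk_apply (g : Gk k) (v : EuclideanSpace ℝ (Fin 3)) :
    diffMk Γ g v = diffAt (QuotientGroup.mk : Gk k → Gk k ⧸ Γ) g v := rfl

/-- The projection is surjective with invertible differentials, so identities between forms on the
quotient may be checked on $G_k$. -/
theorem pullback_mk_injective {p : ℕ} {θ θ' : DForm (EuclideanSpace ℝ (Fin 3)) (Gk k ⧸ Γ) p}
    (h : pullback (E := EuclideanSpace ℝ (Fin 3)) (QuotientGroup.mk : Gk k → Gk k ⧸ Γ) θ
      = pullback (QuotientGroup.mk : Gk k → Gk k ⧸ Γ) θ') :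
    θ = θ' := by
  funext q
  obtain ⟨g, rfl⟩ := QuotientGroup.mk_surjective q
  ext v
  have := congrArg (fun T => T (fun i => (diffMk Γ g).symm (v i))) (congrFun h g)
  simp only [pullback, ContinuousAlternatingMap.compContinuousLinearMap_apply, ← diffMk_apply,
    Function.comp_def, ContinuousLinearEquiv.apply_symm_apply] at this
  exact this

theorem pullback_smul {E E' M M' : Type*} [NormedAddCommGroup E] [NormedSpace ℝ E]
    [NormedAddCommGroup E'] [NormedSpace ℝ E'] [TopologicalSpace M] [ChartedSpace E M]
    [TopologicalSpace M'] [ChartedSpace E' M'] {p : ℕ} (F : M → M') (c : ℝ) (θ : DForm E' M' p) :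
    pullback (E := E) F (c • θ) = c • pullback F θ := rfl

theorem extD_alphaN : extD (alphaN Γ) = k • wedge (gammaN Γ) (alphaN Γ) := by
  refine pullback_mk_injective Γ ?_
  rw [pullback_smul, pullback_wedge, pullback_mk_gammaN, pullback_mk_alphaN, ← extD_alphaG,
    ← pullback_mk_alphaN Γ]
  exact funext fun g => (extD_pullback (isSmooth_alphaN Γ) (contMDiff_mk Γ g)).symm

theorem extD_betaN : extD (betaN Γ) = (-k) • wedge (gammaN Γ) (betaN Γ) := by
  refine pullback_mk_injective Γ ?_
  rw [pullback_smul, pullback_wedge, pullback_mk_gammaN, pullback_mk_betaN, ← extD_betaG,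
    ← pullback_mk_betaN Γ]
  exact funext fun g => (extD_pullback (isSmooth_betaN Γ) (contMDiff_mk Γ g)).symm

theorem extD_gammaN : extD (gammaN Γ) = 0 := by
  refine pullback_mk_injective Γ ?_
  refine Eq.trans ?_ (extD_gammaG (k := k))
  rw [← pullback_mk_gammaN Γ]
  exact funext fun g => (extD_pullback (isSmooth_gammaN Γ) (contMDiff_mk Γ g)).symm

end QuotientForms

/-! ### Local parametrizations of the bundle and the coframe on $M$. -/

section BundleParametrization

open Filter Topology

variable {E : Type*} [NormedAddCommGroup E] [NormedSpace ℝ E]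
  {M : Type*} [TopologicalSpace M] [ChartedSpace E M] [MulAction Circle M]

theorem IsPrincipalCircleBundle.contMDiff_proj {E' N : Type*} [NormedAddCommGroup E']
    [NormedSpace ℝ E'] [TopologicalSpace N] [ChartedSpace E' N] {π : M → N}
    (hπ : IsPrincipalCircleBundle (E := E) (E' := E') π) :
    ContMDiff 𝓘(ℝ, E) 𝓘(ℝ, E') ∞ π := by
  intro m
  obtain ⟨U, hU, hm, Φ, hs, ht, h1, -⟩ := hπ.locally_trivial (π m)
  have hms : m ∈ Φ.source := by rw [hs]; exact hm
  have hsm := Φ.contMDiffOn.contMDiffAt (Φ.open_source.mem_nhds hms)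
  refine (contMDiffAt_fst.comp m hsm).congr_of_eventuallyEq ?_
  filter_upwards [Φ.open_source.mem_nhds hms] with x hx
  exact (h1 x hx).symm

variable {k : ℝ} {Γ : Subgroup (Gk k)} [DiscreteTopology Γ] {π : M → Gk k ⧸ Γ}

/-- A parametrization of `M` over an open set `V` of `G_k`, by points of `V` and an angle. -/
structure IsBundleParam (π : M → Gk k ⧸ Γ) (V : Set (EuclideanSpace ℝ (Fin 3)))
    (T : EuclideanSpace ℝ (Fin 3) × ℝ → M) : Prop where
  isOpen : IsOpen V
  contMDiffAt : ∀ y ∈ V, ∀ s, ContMDiffAt 𝓘(ℝ, EuclideanSpace ℝ (Fin 3) × ℝ) 𝓘(ℝ, E) ∞ T (y, s)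
  proj : ∀ y ∈ V, ∀ s, π (T (y, s)) = QuotientGroup.mk (show Gk k from y)
  smul : ∀ y ∈ V, ∀ s t, T (y, s + t) = Circle.exp (2 * Real.pi * t) • T (y, s)
  exists_eq : ∀ y ∈ V, ∀ m, π m = QuotientGroup.mk (show Gk k from y) → ∃ s, T (y, s) = m

/-- A local trivialization over $U$ is composed with $G_k\to G_k/\Gamma$ on the preimage of $U$ and
with $s\mapsto e^{2\pi is}$. Base and fibre thereby both get linear coordinates. -/
theorem IsPrincipalCircleBundle.exists_param
    (hπ : IsPrincipalCircleBundle (E := E) (E' := EuclideanSpace ℝ (Fin 3)) π)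
    (g : EuclideanSpace ℝ (Fin 3)) :
    ∃ V T, g ∈ V ∧ IsBundleParam (E := E) π V T := by
  obtain ⟨U, hU, hm, Φ, hs, ht, h1, h2⟩ :=
    hπ.locally_trivial (QuotientGroup.mk (show Gk k from g))
  let mk : EuclideanSpace ℝ (Fin 3) → Gk k ⧸ Γ := fun y => QuotientGroup.mk (show Gk k from y)
  have hmk : ContMDiff 𝓘(ℝ, EuclideanSpace ℝ (Fin 3)) 𝓘(ℝ, EuclideanSpace ℝ (Fin 3)) ∞ mk :=
    contMDiff_mk Γ
  have hmem : ∀ y s, mk y ∈ U → (mk y, Circle.exp (2 * Real.pi * s)) ∈ Φ.target := by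
    intro y s hy
    rw [ht]
    exact ⟨hy, Set.mem_univ _⟩
  have hpair : ∀ y s, mk y ∈ U → Φ (Φ.toPartialEquiv.symm (mk y, Circle.exp (2 * Real.pi * s)))
      = (mk y, Circle.exp (2 * Real.pi * s)) := fun y s hy =>
    Φ.toPartialEquiv.right_inv (hmem y s hy)
  have hsrc : ∀ y s, mk y ∈ U →
      Φ.toPartialEquiv.symm (mk y, Circle.exp (2 * Real.pi * s)) ∈ Φ.source := fun y s hy =>
    Φ.toPartialEquiv.map_target (hmem y s hy)
  refine ⟨mk ⁻¹' U, fun p => Φ.toPartialEquiv.symm (mk p.1, Circle.exp (2 * Real.pi * p.2)), hm,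
    hU.preimage hmk.continuous, ?_, ?_, ?_, ?_⟩
  · intro y hy s
    have hin : ContMDiffAt 𝓘(ℝ, EuclideanSpace ℝ (Fin 3) × ℝ)
        (𝓘(ℝ, EuclideanSpace ℝ (Fin 3)).prod (𝓡 1)) ∞
        (fun p : EuclideanSpace ℝ (Fin 3) × ℝ => (mk p.1, Circle.exp (2 * Real.pi * p.2)))
        (y, s) := by
      refine ContMDiffAt.prodMk ?_ ?_
      · exact hmk.contMDiffAt.comp (y, s) contDiff_fst.contMDiff.contMDiffAt
      · exact contMDiff_circleExp.contMDiffAt.comp (y, s)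
          (contDiff_const.mul contDiff_snd).contMDiff.contMDiffAt
    exact ContMDiffAt.comp (y, s)
      (Φ.contMDiffOn_invFun.contMDiffAt (Φ.open_target.mem_nhds (hmem y s hy))) hin
  · intro y hy s
    rw [← h1 _ (hsrc y s hy), hpair y s hy]
  · intro y hy s t
    -- By equivariance both points have the same image under the trivialization, which is injective
    -- on its source.
    obtain ⟨h3, h4⟩ := h2 _ (hsrc y s hy) (Circle.exp (2 * Real.pi * t))
    rw [hpair y s hy, ← Circle.exp_add, ← mul_add, add_comm t s, ← hpair y (s + t) hy] at h4
    exact (Φ.toPartialEquiv.injOn h3 (hsrc y _ hy) h4).symm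
  · intro y hy m hmy
    have hms : m ∈ Φ.source := by
      rw [hs]
      change π m ∈ U
      rw [hmy]; exact hy
    obtain ⟨r, hr⟩ := Circle.exp_surjective (Φ m).2
    refine ⟨r / (2 * Real.pi), ?_⟩
    have e : (mk y, Circle.exp (2 * Real.pi * (r / (2 * Real.pi)))) = Φ m := by
      rw [mul_div_cancel₀ _ (by positivity), hr]
      refine Prod.ext ?_ rfl
      rw [h1 m hms, hmy]
    change Φ.toPartialEquiv.symm (mk y, Circle.exp (2 * Real.pi * (r / (2 * Real.pi)))) = m
    rw [e]
    exact Φ.toPartialEquiv.left_inv hms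

namespace IsBundleParam

variable {V : Set (EuclideanSpace ℝ (Fin 3))} {T : EuclideanSpace ℝ (Fin 3) × ℝ → M}

theorem periodic (h : IsBundleParam (E := E) π V T) {y : EuclideanSpace ℝ (Fin 3)} (hy : y ∈ V)
    (s : ℝ) : T (y, s + 1) = T (y, s) := by
  rw [h.smul y hy, mul_one, Circle.exp_two_pi, one_smul]

/-- Along $t\mapsto(y,s+t)$ the parametrization is the orbit curve whose velocity defines the
fundamental field. -/
theorem diffAt_angle (h : IsBundleParam (E := E) π V T) {y : EuclideanSpace ℝ (Fin 3)}
    (hy : y ∈ V) (s : ℝ) :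
    diffAt T (y, s) ((0, 1) : EuclideanSpace ℝ (Fin 3) × ℝ) = fundamentalField (E := E) (T (y, s)) := by
  have hι : HasFDerivAt (fun t : ℝ => (y, s + t))
      ((ContinuousLinearMap.inr ℝ (EuclideanSpace ℝ (Fin 3)) ℝ)) 0 :=
    (hasFDerivAt_const y (0 : ℝ)).prodMk ((hasFDerivAt_id (0 : ℝ)).const_add s)
  have hT : MDifferentiableAt 𝓘(ℝ, EuclideanSpace ℝ (Fin 3) × ℝ) 𝓘(ℝ, E) T
      ((fun t : ℝ => (y, s + t)) 0) := by
    have := (h.contMDiffAt y hy s).mdifferentiableAt (by simp)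
    simpa using this
  have hc := diffAt_comp (E := ℝ) (E' := EuclideanSpace ℝ (Fin 3) × ℝ) (E'' := E)
    (F := fun t : ℝ => (y, s + t)) hT
    hι.differentiableAt.mdifferentiableAt
  have hd : diffAt (E := ℝ) (E' := EuclideanSpace ℝ (Fin 3) × ℝ) (fun t : ℝ => (y, s + t)) 0
      = ContinuousLinearMap.inr ℝ (EuclideanSpace ℝ (Fin 3)) ℝ :=
    mfderiv_eq_fderiv.trans hι.fderiv
  have he : T ∘ (fun t : ℝ => (y, s + t))
      = fun t : ℝ => Circle.exp (2 * Real.pi * t) • T (y, s) := funext fun t => h.smul y hy s t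
  rw [hd, he, add_zero] at hc
  have := congrArg (fun A => A (1 : ℝ)) hc
  simp only [ContinuousLinearMap.comp_apply, ContinuousLinearMap.inr_apply] at this
  exact this.symm

theorem diffAt_proj (h : IsBundleParam (E := E) π V T)
    (hπ : ContMDiff 𝓘(ℝ, E) 𝓘(ℝ, EuclideanSpace ℝ (Fin 3)) ∞ π) {y : EuclideanSpace ℝ (Fin 3)}
    (hy : y ∈ V) (s : ℝ) (w : EuclideanSpace ℝ (Fin 3) × ℝ) :
    diffAt (E' := EuclideanSpace ℝ (Fin 3)) π (T (y, s)) (diffAt (E' := E) T (y, s) w)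
      = diffMk Γ (show Gk k from y) w.1 := by
  have hT := (h.contMDiffAt y hy s).mdifferentiableAt (by simp)
  have hc := diffAt_comp (E := EuclideanSpace ℝ (Fin 3) × ℝ) (E' := E)
    (E'' := EuclideanSpace ℝ (Fin 3)) (hπ.mdifferentiable (by simp) (T (y, s))) hT
  let mk : EuclideanSpace ℝ (Fin 3) → Gk k ⧸ Γ := fun y => QuotientGroup.mk (show Gk k from y)
  have hmk : ContMDiff 𝓘(ℝ, EuclideanSpace ℝ (Fin 3)) 𝓘(ℝ, EuclideanSpace ℝ (Fin 3)) ∞ mk :=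
    contMDiff_mk Γ
  have he : π ∘ T =ᶠ[𝓝 (y, s)] mk ∘ Prod.fst := by
    filter_upwards [(h.isOpen.preimage continuous_fst).mem_nhds (show (y, s) ∈ Prod.fst ⁻¹' V from hy)]
      with p hp
    exact h.proj p.1 hp p.2
  have hfst : DifferentiableAt ℝ (Prod.fst : EuclideanSpace ℝ (Fin 3) × ℝ → _) (y, s) :=
    differentiableAt_fst
  rw [diffAt_congr he, diffAt_comp (E := EuclideanSpace ℝ (Fin 3) × ℝ)
    (E' := EuclideanSpace ℝ (Fin 3)) (E'' := EuclideanSpace ℝ (Fin 3))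
    (hmk.mdifferentiable (by simp) _) hfst.mdifferentiableAt] at hc
  have hd : diffAt (E := EuclideanSpace ℝ (Fin 3) × ℝ) (E' := EuclideanSpace ℝ (Fin 3))
      (Prod.fst : EuclideanSpace ℝ (Fin 3) × ℝ → _) (y, s)
      = ContinuousLinearMap.fst ℝ (EuclideanSpace ℝ (Fin 3)) ℝ :=
    mfderiv_eq_fderiv.trans fderiv_fst
  rw [hd] at hc
  exact (congrArg (fun A => A w) hc).symm

end IsBundleParam

/-- A form on `G_k / Γ`, pulled back to `M`, is computed in `G_k`. -/
theorem pullback_proj_apply {θ : DForm (EuclideanSpace ℝ (Fin 3)) (Gk k ⧸ Γ) 1}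
    {θ' : DForm (EuclideanSpace ℝ (Fin 3)) (Gk k) 1}
    (hθ : pullback (QuotientGroup.mk : Gk k → Gk k ⧸ Γ) θ = θ') {m : M} {g : Gk k}
    (hm : π m = QuotientGroup.mk g) {v : E} {w : EuclideanSpace ℝ (Fin 3)}
    (hv : diffAt (E' := EuclideanSpace ℝ (Fin 3)) π m v = diffMk Γ g w) :
    pullback π θ m ![v] = θ' g ![w] := by
  rw [← hθ]
  simp only [pullback, ContinuousAlternatingMap.compContinuousLinearMap_apply, hm]
  congr 1
  funext i
  fin_cases i
  exact hv

/-- The equations for $\alpha,\beta,\gamma$ are natural under pullback and the one for $\eta$ is the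
curvature hypothesis. Independence holds because $\alpha,\beta,\gamma$ detect the base direction and
$\eta$ the fibre direction. -/
theorem isSolCoframe [IsManifold 𝓘(ℝ, E) ∞ M] [FiniteDimensional ℝ E] (hE : Module.finrank ℝ E = 4)
    (hπ : IsPrincipalCircleBundle (E := E) (E' := EuclideanSpace ℝ (Fin 3)) π)
    {η : DForm E M 1} (hη : IsConnectionForm η) {c : ℝ}
    (hcurv : extD η = c • wedge (pullback π (alphaN Γ)) (pullback π (betaN Γ))) :
    IsSolCoframe k c (pullback π (alphaN Γ)) (pullback π (betaN Γ)) (pullback π (gammaN Γ)) η := by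
  have hsm := hπ.contMDiff_proj
  have hex : ∀ (x : M) (a b c d : ℝ), ∃ v : E, pullback π (alphaN Γ) x ![v] = a ∧
      pullback π (betaN Γ) x ![v] = b ∧ pullback π (gammaN Γ) x ![v] = c ∧ η x ![v] = d := by
    intro x a b c d
    obtain ⟨g, hg⟩ := QuotientGroup.mk_surjective (π x)
    obtain ⟨V, T, hgV, hT⟩ := hπ.exists_param (show EuclideanSpace ℝ (Fin 3) from g)
    obtain ⟨s, rfl⟩ := hT.exists_eq _ hgV x hg.symm
    -- Solution of $dx-kx\,dz=a$, $dy+ky\,dz=b$, $dz=c$ at $g$. The angular component is then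
    -- corrected by $d-r_0$, using $\eta(X)=1$ for the fundamental field $X$.
    let w : EuclideanSpace ℝ (Fin 3) := !₂[a + k * g.x * c, b - k * g.y * c, c]
    have hv : ∀ r : ℝ, diffAt (E' := EuclideanSpace ℝ (Fin 3)) π (T (g, s))
        (diffAt (E' := E) T (g, s) ((w, r) : EuclideanSpace ℝ (Fin 3) × ℝ)) = diffMk Γ g w :=
      fun r => hT.diffAt_proj hsm hgV s (w, r)
    let r₀ := η (T (g, s)) ![diffAt (E' := E) T (g, s) ((w, 0) : EuclideanSpace ℝ (Fin 3) × ℝ)]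
    refine ⟨diffAt (E' := E) T (g, s) ((w, d - r₀) : EuclideanSpace ℝ (Fin 3) × ℝ), ?_, ?_, ?_, ?_⟩
    · rw [pullback_proj_apply (pullback_mk_alphaN Γ) hg.symm (hv _)]
      simp only [Gk.alpha, Gk.covector_apply, w]
      simp
    · rw [pullback_proj_apply (pullback_mk_betaN Γ) hg.symm (hv _)]
      simp only [Gk.beta, Gk.covector_apply, w]
      simp
    · rw [pullback_proj_apply (pullback_mk_gammaN Γ) hg.symm (hv _)]
      simp only [Gk.gamma, Gk.covector_apply, w]
      simp
    · have e : ((w, d - r₀) : EuclideanSpace ℝ (Fin 3) × ℝ) = (w, 0) + (d - r₀) • (0, 1) := by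
        simp
      rw [e, map_add, map_smul, form_one_add, form_one_smul, hT.diffAt_angle hgV, hη.fundamental]
      simp only [r₀]
      ring
  refine ⟨isSmooth_pullback (isSmooth_alphaN Γ) hsm, isSmooth_pullback (isSmooth_betaN Γ) hsm,
    isSmooth_pullback (isSmooth_gammaN Γ) hsm, hη.smooth, ?_, ?_, ?_, hcurv, hex, ?_⟩
  · rw [← pullback_wedge, ← pullback_smul, ← extD_alphaN]
    exact funext fun x => extD_pullback (isSmooth_alphaN Γ) (hsm x)
  · rw [← pullback_wedge, ← pullback_smul, ← extD_betaN]
    exact funext fun x => extD_pullback (isSmooth_betaN Γ) (hsm x)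
  · refine funext fun x => (extD_pullback (isSmooth_gammaN Γ) (hsm x)).trans ?_
    rw [extD_gammaN]
    rfl
  · intro x v h1 h2 h3 h4
    let ev : (E [⋀^Fin 1]→L[ℝ] ℝ) → E →ₗ[ℝ] ℝ := fun a =>
      { toFun := fun u => a ![u]
        map_add' := form_one_add a
        map_smul' := fun t u => form_one_smul a t u }
    let L : E →ₗ[ℝ] (Fin 4 → ℝ) := LinearMap.pi ![ev (pullback π (alphaN Γ) x),
      ev (pullback π (betaN Γ) x), ev (pullback π (gammaN Γ) x), ev (η x)]
    have hL : Function.Surjective L := by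
      intro t
      obtain ⟨u, u1, u2, u3, u4⟩ := hex x (t 0) (t 1) (t 2) (t 3)
      refine ⟨u, funext fun i => ?_⟩
      fin_cases i
      exacts [u1, u2, u3, u4]
    -- The four covectors were shown to take arbitrary values; in dimension 4 they are then jointly
    -- injective.
    have hinj := (LinearMap.injective_iff_surjective_of_finrank_eq_finrank (f := L)
      (by simp [hE])).2 hL
    apply hinj
    rw [map_zero]
    funext i
    fin_cases i
    exacts [h1, h2, h3, h4]

end BundleParametrization

/-! ### Fibre integrals, Stokes and the maximum argument. -/

section Averaging

open Filter Topology

/-- Stokes' theorem for a `1`-form on a cylinder `[0, r] × S¹`, the form being given on the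
universal cover of the cylinder. -/
theorem integral_sub_integral_eq {X : Type*} [NormedAddCommGroup X] [NormedSpace ℝ X] {V : Set X}
    {ζ : X × ℝ → (X × ℝ) [⋀^Fin 1]→L[ℝ] ℝ} (hζ : ∀ y ∈ V, ∀ s, ContDiffAt ℝ ∞ ζ (y, s))
    (hper : ∀ y ∈ V, ∀ s, ζ (y, s + 1) = ζ (y, s)) {e : X} {t : ℝ}
    (hd : ∀ y ∈ V, ∀ s, extDeriv ζ (y, s) ![((e, 0) : X × ℝ), (0, 1)] = t) {g : X} {r : ℝ}
    (hV : ∀ x ∈ Set.uIcc 0 r, g + x • e ∈ V) :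
    (∫ s in (0 : ℝ)..1, ζ (g + r • e, s) ![((0, 1) : X × ℝ)])
      - ∫ s in (0 : ℝ)..1, ζ (g, s) ![((0, 1) : X × ℝ)] = r * t := by
  let ι : ℝ × ℝ → X × ℝ := fun p => (g + p.1 • e, p.2)
  let D : ℝ × ℝ →L[ℝ] X × ℝ :=
    ((ContinuousLinearMap.fst ℝ ℝ ℝ).smulRight e).prod (ContinuousLinearMap.snd ℝ ℝ ℝ)
  have hι : ∀ p, HasFDerivAt ι D p := fun p =>
    (((ContinuousLinearMap.fst ℝ ℝ ℝ).smulRight e).hasFDerivAt.const_add g).prodMk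
      (ContinuousLinearMap.snd ℝ ℝ ℝ).hasFDerivAt
  have hdiff : ∀ p : ℝ × ℝ, p.1 ∈ Set.uIcc 0 r → ∀ v : X × ℝ, HasFDerivAt
      (fun p => ζ (ι p) ![v]) ((fderiv ℝ (fun q => ζ q ![v]) (ι p)).comp D) p := by
    intro p hp v
    have h1 := (hζ _ (hV _ hp) p.2).differentiableAt (by simp)
    exact HasFDerivAt.comp p (differentiableAt_form_apply h1 ![v]).hasFDerivAt (hι p)
  -- The divergence of $(\zeta(\partial_s),-\zeta(e))$ on the rectangle is $d\zeta(e,\partial_s)$,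
  -- the constant $t$; this also settles integrability.
  have hsum : ∀ p : ℝ × ℝ, p.1 ∈ Set.uIcc 0 r →
      (fderiv ℝ (fun q => ζ q ![((0, 1) : X × ℝ)]) (ι p)).comp D (1, 0)
      + (-(fderiv ℝ (fun q => ζ q ![((e, 0) : X × ℝ)]) (ι p)).comp D) (0, 1) = t := by
    intro p hp
    have h1 := (hζ _ (hV _ hp) p.2).differentiableAt (by simp)
    have h2 := hd _ (hV _ hp) p.2
    rw [extDeriv_one_apply h1] at h2
    rw [← h2]
    simp [D, ι, sub_eq_add_neg]
  have hIoo : ∀ a b : ℝ, Set.Ioo (min a b) (max a b) ⊆ Set.uIcc a b := fun a b =>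
    Set.Ioo_subset_Icc_self
  have key := MeasureTheory.integral2_divergence_prod_of_hasFDerivAt
    (fun p => ζ (ι p) ![((0, 1) : X × ℝ)]) (fun p => -ζ (ι p) ![((e, 0) : X × ℝ)])
    (fun p => (fderiv ℝ (fun q => ζ q ![((0, 1) : X × ℝ)]) (ι p)).comp D)
    (fun p => -(fderiv ℝ (fun q => ζ q ![((e, 0) : X × ℝ)]) (ι p)).comp D) 0 0 r 1
    (fun p hp => (hdiff p hp.1 _).continuousAt.continuousWithinAt)
    (fun p hp => (hdiff p hp.1 _).neg.continuousAt.continuousWithinAt)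
    (fun p hp => hdiff p (hIoo _ _ hp.1) _) (fun p hp => (hdiff p (hIoo _ _ hp.1) _).neg)
    ((MeasureTheory.integrableOn_const (C := t)
        (isCompact_uIcc.prod isCompact_uIcc).measure_lt_top.ne).congr_fun
      (fun p hp => (hsum p hp.1).symm) (measurableSet_uIcc.prod measurableSet_uIcc))
  have hL : (∫ x in (0 : ℝ)..r, ∫ s in (0 : ℝ)..1,
      (fderiv ℝ (fun q => ζ q ![((0, 1) : X × ℝ)]) (ι (x, s))).comp D (1, 0)
      + (-(fderiv ℝ (fun q => ζ q ![((e, 0) : X × ℝ)]) (ι (x, s))).comp D) (0, 1))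
      = r * t := by
    rw [intervalIntegral.integral_congr (g := fun _ => t)]
    · simp
    · intro x hx
      simp only [fun s => hsum (x, s) hx]
      simp
  -- The edges $s=0$ and $s=1$ carry the same integral by periodicity, so they cancel.
  have hside : ∫ x in (0 : ℝ)..r, -ζ (ι (x, 1)) ![((e, 0) : X × ℝ)]
      = ∫ x in (0 : ℝ)..r, -ζ (ι (x, 0)) ![((e, 0) : X × ℝ)] := by
    refine intervalIntegral.integral_congr fun x hx => ?_
    have := hper _ (hV x hx) 0
    rw [zero_add] at this
    simp only [ι, this]
  rw [hL, hside] at key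
  simp only [ι, zero_smul, add_zero] at key
  linarith

variable {E : Type*} [NormedAddCommGroup E] [NormedSpace ℝ E]
  {M : Type*} [TopologicalSpace M] [ChartedSpace E M]
  [MulAction Circle M] {k : ℝ} {Γ : Subgroup (Gk k)} [DiscreteTopology Γ] {π : M → Gk k ⧸ Γ}

namespace IsBundleParam

variable {V : Set (EuclideanSpace ℝ (Fin 3))} {T : EuclideanSpace ℝ (Fin 3) × ℝ → M}

theorem contDiffAt_pullback [IsManifold 𝓘(ℝ, E) ∞ M] (h : IsBundleParam (E := E) π V T) {ξ : DForm E M 1} (hξ : IsSmooth ξ)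
    {y : EuclideanSpace ℝ (Fin 3)} (hy : y ∈ V) (s : ℝ) :
    ContDiffAt ℝ ∞ (pullback (E := EuclideanSpace ℝ (Fin 3) × ℝ) T ξ) (y, s) := by
  have := contDiffAt_inChart_pullback (x₀ := (y, s)) (y := (y, s)) hξ
    (by rw [extChartAt_model_space_eq_id]; trivial)
    (by rw [extChartAt_model_space_eq_id]; exact h.contMDiffAt y hy s)
  rwa [inChart_self] at this

theorem pullback_periodic (h : IsBundleParam (E := E) π V T) (ξ : DForm E M 1)
    {y : EuclideanSpace ℝ (Fin 3)} (hy : y ∈ V) (s : ℝ) :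
    pullback (E := EuclideanSpace ℝ (Fin 3) × ℝ) T ξ (y, s + 1) = pullback T ξ (y, s) := by
  let τ : EuclideanSpace ℝ (Fin 3) × ℝ → EuclideanSpace ℝ (Fin 3) × ℝ := fun p => p + (0, 1)
  have hτ : HasFDerivAt τ (ContinuousLinearMap.id ℝ _) (y, s) := (hasFDerivAt_id _).add_const _
  have hτy : τ (y, s) = (y, s + 1) := by simp [τ]
  have hT : MDifferentiableAt 𝓘(ℝ, EuclideanSpace ℝ (Fin 3) × ℝ) 𝓘(ℝ, E) T (τ (y, s)) := by
    rw [hτy]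
    exact (h.contMDiffAt y hy _).mdifferentiableAt (by simp)
  have hc := pullback_pullback_apply hT hτ.differentiableAt.mdifferentiableAt ξ
  have he : T ∘ τ =ᶠ[𝓝 (y, s)] T := by
    filter_upwards [(h.isOpen.preimage continuous_fst).mem_nhds (show (y, s) ∈ Prod.fst ⁻¹' V from hy)]
      with p hp
    have : τ p = (p.1, p.2 + 1) := by simp [τ, Prod.ext_iff]
    rw [Function.comp_apply, this]
    exact h.periodic hp p.2
  rw [pullback_congr he] at hc
  rw [← hc, ← hτy]
  have hid : diffAt (E := EuclideanSpace ℝ (Fin 3) × ℝ) (E' := EuclideanSpace ℝ (Fin 3) × ℝ) τ (y, s)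
      = ContinuousLinearMap.id ℝ _ := mfderiv_eq_fderiv.trans hτ.fderiv
  rw [pullback, pullback, hid]
  rfl

theorem pullback_angle (h : IsBundleParam (E := E) π V T) (ξ : DForm E M 1)
    {y : EuclideanSpace ℝ (Fin 3)} (hy : y ∈ V) (s : ℝ) :
    pullback T ξ (y, s) ![((0, 1) : EuclideanSpace ℝ (Fin 3) × ℝ)]
      = ξ (T (y, s)) ![fundamentalField (T (y, s))] := by
  rw [pullback, ContinuousAlternatingMap.compContinuousLinearMap_apply]
  congr 1
  funext i
  fin_cases i
  exact h.diffAt_angle hy s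

/-- Another starting point on the orbit shifts the angle, which does not change the integral of a
1-periodic function over a period. The fibre integral thus depends only on the base point. -/
theorem integral_orbit (h : IsBundleParam (E := E) π V T) (ξ : DForm E M 1)
    {y : EuclideanSpace ℝ (Fin 3)} (hy : y ∈ V) {m : M}
    (hm : π m = QuotientGroup.mk (show Gk k from y)) :
    ∫ s in (0 : ℝ)..1, ξ (Circle.exp (2 * Real.pi * s) • m)
        ![fundamentalField (Circle.exp (2 * Real.pi * s) • m)]
      = ∫ s in (0 : ℝ)..1, pullback T ξ (y, s) ![((0, 1) : EuclideanSpace ℝ (Fin 3) × ℝ)] := by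
  obtain ⟨s₀, rfl⟩ := h.exists_eq y hy m hm
  simp only [← h.smul y hy, ← h.pullback_angle ξ hy]
  have hp : Function.Periodic
      (fun s => pullback T ξ (y, s) ![((0, 1) : EuclideanSpace ℝ (Fin 3) × ℝ)]) 1 := fun s => by
    simp only [h.pullback_periodic ξ hy s]
  have h1 := hp.intervalIntegral_add_eq s₀ 0
  rw [zero_add] at h1
  rw [← h1, intervalIntegral.integral_comp_add_left
    (fun s => pullback T ξ (y, s) ![((0, 1) : EuclideanSpace ℝ (Fin 3) × ℝ)]) s₀, add_zero]

end IsBundleParam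

/-- Over a compact quotient, `dξ (v, X)` cannot be a nonzero constant, where `X` is the fundamental
vector field and `v` is any lift of a fixed coordinate vector field of `G_k`. -/
theorem eq_zero_of_extD_apply_eq [IsManifold 𝓘(ℝ, E) ∞ M] [CompactSpace (Gk k ⧸ Γ)]
    (hπ : IsPrincipalCircleBundle (E := E) (E' := EuclideanSpace ℝ (Fin 3)) π) {ξ : DForm E M 1}
    (hξ : IsSmooth ξ) (e : EuclideanSpace ℝ (Fin 3)) {t : ℝ}
    (h : ∀ (g : Gk k) (m : M) (v : E), π m = QuotientGroup.mk g →
      diffAt (E' := EuclideanSpace ℝ (Fin 3)) π m v = diffMk Γ g e →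
      extD ξ m ![v, fundamentalField m] = t) : t = 0 := by
  have hsm := hπ.contMDiff_proj
  have hsurj : Function.Surjective π := by
    intro q
    obtain ⟨g, rfl⟩ := QuotientGroup.mk_surjective q
    obtain ⟨V, T, hg, hT⟩ := hπ.exists_param (show EuclideanSpace ℝ (Fin 3) from g)
    exact ⟨T (g, 0), hT.proj g hg 0⟩
  -- The starting points are chosen with no continuity. This is harmless, since `integral_orbit`
  -- identifies the value with the integral in any local parametrization.
  let mean : Gk k ⧸ Γ → ℝ := fun q => ∫ s in (0 : ℝ)..1,
    ξ (Circle.exp (2 * Real.pi * s) • Function.surjInv hsurj q)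
      ![fundamentalField (Circle.exp (2 * Real.pi * s) • Function.surjInv hsurj q)]
  let mk : EuclideanSpace ℝ (Fin 3) → Gk k ⧸ Γ := fun y => QuotientGroup.mk (show Gk k from y)
  have hmean : ∀ {V T}, IsBundleParam (E := E) π V T → ∀ y ∈ V, mean (mk y)
      = ∫ s in (0 : ℝ)..1, pullback T ξ (y, s) ![((0, 1) : EuclideanSpace ℝ (Fin 3) × ℝ)] :=
    fun hT y hy => hT.integral_orbit ξ hy (Function.surjInv_eq hsurj _)
  have hcont : Continuous mean := by
    have hq : Topology.IsQuotientMap (QuotientGroup.mk : Gk k → Gk k ⧸ Γ) :=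
      QuotientGroup.isQuotientMap_mk Γ
    -- Continuity is checked on $G_k$, where locally the function is an integral depending on a
    -- parameter.
    rw [hq.continuous_iff]
    refine (continuous_iff_continuousAt (X := EuclideanSpace ℝ (Fin 3))).2 fun g => ?_
    obtain ⟨V, T, hg, hT⟩ := hπ.exists_param g
    have hVn := hT.isOpen.mem_nhds hg
    refine ContinuousOn.continuousAt (s := V) ?_ hVn
    have hc : ContinuousOn (fun y => ∫ s in (0 : ℝ)..1,
        pullback T ξ (y, s) ![((0, 1) : EuclideanSpace ℝ (Fin 3) × ℝ)]) V := by
      rw [continuousOn_iff_continuous_domRestrict]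
      refine intervalIntegral.continuous_parametric_intervalIntegral_of_continuous'
        (f := fun (y : V) s => pullback T ξ (y.1, s) ![((0, 1) : EuclideanSpace ℝ (Fin 3) × ℝ)])
        ?_ 0 1
      refine continuous_iff_continuousAt.2 fun p => ?_
      have h1 := (differentiableAt_form_apply ((hT.contDiffAt_pullback hξ p.1.2 p.2).differentiableAt
        (by simp)) ![((0, 1) : EuclideanSpace ℝ (Fin 3) × ℝ)]).continuousAt
      exact ContinuousAt.comp (f := fun p : V × ℝ => (p.1.1, p.2)) h1
        ((continuous_subtype_val.comp continuous_fst).prodMk continuous_snd).continuousAt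
    exact hc.congr fun y hy => hmean hT y hy
  obtain ⟨q, -, hmax⟩ := isCompact_univ.exists_isMaxOn (Set.univ_nonempty (α := Gk k ⧸ Γ))
    hcont.continuousOn
  obtain ⟨g, rfl⟩ := QuotientGroup.mk_surjective q
  obtain ⟨V, T, hg, hT⟩ := hπ.exists_param (show EuclideanSpace ℝ (Fin 3) from g)
  let g' : EuclideanSpace ℝ (Fin 3) := g
  have hext : ∀ y ∈ V, ∀ s, extDeriv (pullback (E := EuclideanSpace ℝ (Fin 3) × ℝ) T ξ) (y, s)
      ![((e, 0) : EuclideanSpace ℝ (Fin 3) × ℝ), (0, 1)] = t := by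
    intro y hy s
    rw [← extD_self, extD_pullback hξ (hT.contMDiffAt y hy s),
      ← h y (T (y, s)) (diffAt (E' := E) T (y, s) ((e, 0) : EuclideanSpace ℝ (Fin 3) × ℝ))
      (hT.proj y hy s) (hT.diffAt_proj hsm hy s (e, 0)), pullback,
      ContinuousAlternatingMap.compContinuousLinearMap_apply]
    congr 1
    funext i
    fin_cases i
    · rfl
    · exact hT.diffAt_angle hy s
  have hline : ContinuousAt (fun x : ℝ => g' + x • e) 0 := by fun_prop
  have hnear : ∀ᶠ x : ℝ in 𝓝 0, g' + x • e ∈ V :=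
    hline.eventually (by simpa using hT.isOpen.mem_nhds hg)
  obtain ⟨ε, hε, hball⟩ := Metric.eventually_nhds_iff.1 hnear
  -- By Stokes, $rt$ is the increment of the fibre integral from the maximum point to its translate
  -- by $re$. Taking $r=\pm\varepsilon/2$ leaves only $t=0$.
  have hle : ∀ r : ℝ, |r| < ε → r * t ≤ 0 := by
    intro r hr
    have hV : ∀ x ∈ Set.uIcc 0 r, g' + x • e ∈ V := by
      intro x hx
      refine hball ?_
      rw [Real.dist_eq]
      exact (Set.abs_sub_left_of_mem_uIcc hx).trans_lt (by simpa using hr)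
    have := integral_sub_integral_eq (fun y hy s => hT.contDiffAt_pullback hξ hy s)
      (fun y hy s => hT.pullback_periodic ξ hy s) hext hV
    rw [← this, ← hmean hT _ (hV r Set.right_mem_uIcc), ← hmean hT g' hg, sub_nonpos]
    exact hmax (Set.mem_univ _)
  have h1 := hle (ε / 2) (by rw [abs_of_pos (by positivity)]; linarith)
  have h2 := hle (-(ε / 2)) (by rw [abs_neg, abs_of_pos (by positivity)]; linarith)
  nlinarith

theorem fundamentalField_proj
    (hπ : IsPrincipalCircleBundle (E := E) (E' := EuclideanSpace ℝ (Fin 3)) π) {m : M} {g : Gk k}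
    (hm : π m = QuotientGroup.mk g) :
    diffAt (E' := EuclideanSpace ℝ (Fin 3)) π m (fundamentalField (E := E) m) = diffMk Γ g 0 := by
  obtain ⟨V, T, hg, hT⟩ := hπ.exists_param (show EuclideanSpace ℝ (Fin 3) from g)
  obtain ⟨s, rfl⟩ := hT.exists_eq _ hg m hm
  have := hT.diffAt_proj hπ.contMDiff_proj hg s (0, 1)
  rwa [hT.diffAt_angle hg] at this

/-- `Ω` is not equivalent to `Ω_(t₁, t₂, t₃)` if some coordinate vector field of `G_k` is dual to `α`
with respect to the coframe `α, β, γ`. -/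
theorem not_equivalent_OmegaT [IsManifold 𝓘(ℝ, E) ∞ M] [CompactSpace (Gk k ⧸ Γ)]
    (hπ : IsPrincipalCircleBundle (E := E) (E' := EuclideanSpace ℝ (Fin 3)) π)
    {α β γ η : DForm E M 1} {a c : ℝ} (h : IsSolCoframe a c α β γ η) (hη : IsConnectionForm η)
    (ha : a ≠ 0) (hc : c ≠ 0)
    (hX : ∀ m, α m ![fundamentalField m] = 0 ∧ β m ![fundamentalField m] = 0
      ∧ γ m ![fundamentalField m] = 0)
    {e : EuclideanSpace ℝ (Fin 3)} (he : ∀ (g : Gk k) (m : M) (v : E), π m = QuotientGroup.mk g →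
      diffAt (E' := EuclideanSpace ℝ (Fin 3)) π m v = diffMk Γ g e →
      α m ![v] = 1 ∧ β m ![v] = 0 ∧ γ m ![v] = 0) {t₁ t₂ t₃ : ℝ} (ht₁ : t₁ ≠ 0)
    (ht : t₁ * t₂ ≠ c * a * t₃ ^ 2) :
    ¬ Equivalent (Omega a c α β γ η) (OmegaT a c α β γ η t₁ t₂ t₃) := by
  intro heq
  obtain ⟨ξ, hξ, hd⟩ := h.exists_primitive_of_equivalent ha hc ht heq
  refine ht₁ (eq_zero_of_extD_apply_eq hπ hξ e fun g m v hm hv => ?_)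
  obtain ⟨v1, v2, v3⟩ := he g m v hm hv
  obtain ⟨X1, X2, X3⟩ := hX m
  -- On $(v,X)$ all terms with $\beta$ or $\gamma$ vanish, and $t_1\alpha(v)\eta(X)=t_1$ remains.
  rw [hd, Pi.add_apply, ContinuousAlternatingMap.add_apply, OmegaT_apply, Pi.smul_apply,
    ContinuousAlternatingMap.smul_apply, wedge_one_apply, v1, v2, v3, X1, X2, X3, hη.fundamental]
  simp

end Averaging

end ACFM

end

/-! ### The theorem for both families. -/

theorem corollary1
    (k : ℝ) (hk : ∃ m : ℤ, m ≠ 2 ∧ Real.exp k + Real.exp (-k) = m)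
    (Γ : Subgroup (ACFM.Gk k)) [DiscreteTopology Γ] [CompactSpace (ACFM.Gk k ⧸ Γ)]
    (n : ℤ) (hn : n ≠ 0) (l : ℝ) (hl : l ≠ 0)
    {M : Type*} [TopologicalSpace M] [T2Space M] [ChartedSpace (EuclideanSpace ℝ (Fin 4)) M]
    [IsManifold 𝓘(ℝ, EuclideanSpace ℝ (Fin 4)) ∞ M] [MulAction Circle M]
    (π : M → ACFM.Gk k ⧸ Γ)
    (hπ : ACFM.IsPrincipalCircleBundle (E := EuclideanSpace ℝ (Fin 4))
      (E' := EuclideanSpace ℝ (Fin 3)) π)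
    (α β γ η : ACFM.DForm (EuclideanSpace ℝ (Fin 4)) M 1)
    (hα : α = ACFM.pullback π (ACFM.alphaN Γ))
    (hβ : β = ACFM.pullback π (ACFM.betaN Γ))
    (hγ : γ = ACFM.pullback π (ACFM.gammaN Γ))
    (hη : ACFM.IsConnectionForm η)
    (hcurv : ACFM.extD η = (n * l : ℝ) • ACFM.wedge α β) :
    (ACFM.Omega k (n * l) α β γ η = ACFM.lichD (-k • γ) η ∧
      ACFM.IsLCS (ACFM.Omega k (n * l) α β γ η) (-k • γ)) ∧
    (ACFM.Omega' k (n * l) α β γ η = ACFM.lichD (k • γ) η ∧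
      ACFM.IsLCS (ACFM.Omega' k (n * l) α β γ η) (k • γ)) ∧
    (∀ t₁ t₂ t₃ : ℝ, t₁ * t₂ ≠ 0 → t₁ * t₂ ≠ n * k * l * t₃ ^ 2 →
      ¬ ACFM.Equivalent (ACFM.Omega k (n * l) α β γ η)
        (ACFM.OmegaT k (n * l) α β γ η t₁ t₂ t₃)) ∧
    (∀ s₁ s₂ s₃ : ℝ, s₁ * s₂ ≠ 0 → s₁ * s₂ ≠ n * k * l * s₃ ^ 2 →
      ¬ ACFM.Equivalent (ACFM.Omega' k (n * l) α β γ η)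
        (ACFM.OmegaS k (n * l) α β γ η s₁ s₂ s₃)) := by
  -- For $k=0$ the sum $e^k+e^{-k}$ would be the excluded integer 2.
  have hk0 : k ≠ 0 := by
    rintro rfl
    obtain ⟨m, hm, h⟩ := hk
    apply hm
    rw [neg_zero, Real.exp_zero] at h
    have : (m : ℝ) = 2 := by linarith
    exact_mod_cast this
  have hc : (n * l : ℝ) ≠ 0 := mul_ne_zero (Int.cast_ne_zero.2 hn) hl
  subst hα hβ hγ
  have h := ACFM.isSolCoframe (by simp) hπ hη hcurv
  have hX : ∀ m, ACFM.pullback π (ACFM.alphaN Γ) m ![ACFM.fundamentalField (E := EuclideanSpace ℝ (Fin 4)) m] = 0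
      ∧ ACFM.pullback π (ACFM.betaN Γ) m ![ACFM.fundamentalField (E := EuclideanSpace ℝ (Fin 4)) m] = 0
      ∧ ACFM.pullback π (ACFM.gammaN Γ) m ![ACFM.fundamentalField (E := EuclideanSpace ℝ (Fin 4)) m] = 0 := by
    intro m
    obtain ⟨g, hg⟩ := QuotientGroup.mk_surjective (π m)
    have hf := ACFM.fundamentalField_proj hπ hg.symm
    rw [ACFM.pullback_proj_apply (ACFM.pullback_mk_alphaN Γ) hg.symm hf,
      ACFM.pullback_proj_apply (ACFM.pullback_mk_betaN Γ) hg.symm hf,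
      ACFM.pullback_proj_apply (ACFM.pullback_mk_gammaN Γ) hg.symm hf]
    simp [ACFM.Gk.alpha, ACFM.Gk.beta, ACFM.Gk.gamma, ACFM.Gk.covector_apply]
  -- Without a $z$-component the terms $-kx\,dz$ and $ky\,dz$ drop out, so $\partial_x$ and
  -- $\partial_y$ are dual to $\alpha$ and $\beta$ at every point.
  have hlift : ∀ (w : EuclideanSpace ℝ (Fin 3)) (g : ACFM.Gk k) (m : M)
      (v : EuclideanSpace ℝ (Fin 4)), w 2 = 0 → π m = QuotientGroup.mk g →
      ACFM.diffAt (E' := EuclideanSpace ℝ (Fin 3)) π m v = ACFM.diffMk Γ g w →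
      ACFM.pullback π (ACFM.alphaN Γ) m ![v] = w 0
      ∧ ACFM.pullback π (ACFM.betaN Γ) m ![v] = w 1
      ∧ ACFM.pullback π (ACFM.gammaN Γ) m ![v] = 0 := by
    intro w g m v hw hm hv
    rw [ACFM.pullback_proj_apply (ACFM.pullback_mk_alphaN Γ) hm hv,
      ACFM.pullback_proj_apply (ACFM.pullback_mk_betaN Γ) hm hv,
      ACFM.pullback_proj_apply (ACFM.pullback_mk_gammaN Γ) hm hv]
    simp [ACFM.Gk.alpha, ACFM.Gk.beta, ACFM.Gk.gamma, ACFM.Gk.covector_apply, hw]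
  have h' := h.swap
  refine ⟨⟨h.Omega_eq_lichD, h.isLCS_Omega hk0 hc⟩, ?_, fun t₁ t₂ t₃ ht ht' => ?_,
    fun s₁ s₂ s₃ hs hs' => ?_⟩
  · have h1 := h'.Omega_eq_lichD
    have h2 := h'.isLCS_Omega (neg_ne_zero.2 hk0) (neg_ne_zero.2 hc)
    rw [neg_neg] at h1 h2
    rw [ACFM.Omega'_eq_Omega]
    exact ⟨h1, h2⟩
  · refine ACFM.not_equivalent_OmegaT hπ h hη hk0 hc hX (e := !₂[1, 0, 0])
      (fun g m v hm hv => ?_) (left_ne_zero_of_mul ht) (by convert ht' using 1; ring)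
    simpa using hlift _ g m v (by simp) hm hv
  · rw [ACFM.Omega'_eq_Omega, ACFM.OmegaS_eq_OmegaT]
    -- In the swapped coframe $\beta$ comes first, hence the direction $\partial_y$; the product
    -- $ck$ is unchanged by the two sign changes.
    refine ACFM.not_equivalent_OmegaT hπ h' hη (neg_ne_zero.2 hk0) (neg_ne_zero.2 hc)
      (fun m => ⟨(hX m).2.1, (hX m).1, (hX m).2.2⟩) (e := !₂[0, 1, 0])
      (fun g m v hm hv => ?_) (left_ne_zero_of_mul hs) (by convert hs' using 1; ring)
    obtain ⟨v1, v2, v3⟩ := hlift _ g m v (by simp) hm hv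
    exact ⟨by simpa using v2, by simpa using v1, v3⟩
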